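/- Let $a,b,c,d,t$ be nonzero complex numbers such that $t$ is not a root of unity and $abcd\,t^{k}\neq 1$ for all integers $k\ge -1$. Set $$f(s)=\frac{(1-abcds/t)(1-ts)(1-abs)(1-acs)(1-ads)(1-bcs)(1-bds)(1-cds)}{(1-abcds^2/t)(1-abcds^2)^2(1-abcdts^2)},$$ $$g_1(s)=\frac{a+b+c+d-(abc+abd+acd+bcd)s/t}{1-abcds^2/t^2}\cdot\frac{1-s}{1-t},\qquad g(s)=g_1(s)-g_1(ts),$$ with $g_1(1)=0$ also when $abcd=t^2$. There is a unique infinite complex matrix $\mathcal C=(\mathcal C_{i,j})_{i,j\ge 0}$ such that $\mathcal C_{i,j}=0$ for $i>j$, $\mathcal C_{i,i}=1$ for all $i\ge 0$, and, with the convention $\mathcal C_{-1,j}=0$, $$\mathcal C_{i,j}=\mathcal C_{i-1,j-1}+g(t^i)\,\mathcal C_{i,j-1}+f(t^i)\,\mathcal C_{i+1,j-1}\qquad(i\ge 0,\ j\ge 1).$$ Moreover, for every complex $q$ with $0<|q|<1$, every square root $\alpha$ of $abcd/q$, and every $n\ge 1$, the following holds. For a partition $\lambda=(\lambda_1\ge\dots\ge\lambda_n\ge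 0)$ let $m_\lambda$ be the sum of the distinct monomials in the orbit of $x_1^{\lambda_1}\cdots x_n^{\lambda_n}$ under permutations of the variables and inversions $x_i\mapsto 1/x_i$; write $\mu\le\lambda$ if $\mu_1+\dots+\mu_k\le\lambda_1+\dots+\lambda_k$ for $1\le k\le n$. Let $$\Phi_i(x)=\frac{(1-ax_i)(1-bx_i)(1-cx_i)(1-dx_i)}{\alpha t^{n-1}(1-x_i^2)(1-qx_i^2)}\prod_{j\ne i}\frac{(1-tx_ix_j)(1-tx_i/x_j)}{(1-x_ix_j)(1-x_i/x_j)},$$ let $\Phi_i^-(x)$ be obtained from $\Phi_i(x)$ by replacing $x_i$ by $1/x_i$, and let $$\mathcal D_x=\sum_{i=1}^n\Phi_i(x)\,(T_{q,x_i}-1)+\sum_{i=1}^n\Phi_i^-(x)\,(T_{q,x_i}^{-1}-1),$$ where $T_{q,x_i}^{\pm1}$ substitutes $q^{\pm1}x_i$ for $x_i$. The Koornwinder polynomial $P_\lambda=P_\lambda(x|a,b,c,d|q,t)$ is the Laurent polynomial in $x_1,\dots,x_n$ characterized by $P_\lambda\in m_\lambda+\operatorname{span}_{\mathbb C}\{m_\mu:\mu<\lambda\}$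 and $\mathcal D_xP_\lambda=d_\lambda P_\lambda$, where $$d_\lambda=\sum_{j=1}^n\Bigl(\alpha t^{n-j}q^{\lambda_j}+\alpha^{-1}t^{j-n}q^{-\lambda_j}-\alpha t^{n-j}-\alpha^{-1}t^{j-n}\Bigr).$$ For each $0\le r\le n$ these conditions with $\lambda=(1^r)$ have exactly one solution $P_{(1^r)}$, and with the infinite column vectors $$\mathbf P^{(n)}={}^t(P_{(1^n)},P_{(1^{n-1})},\dots,P_{(1)},P_\varnothing,0,0,\dots),\qquad \mathbf m^{(n)}={}^t(m_{(1^n)},m_{(1^{n-1})},\dots,m_{(1)},m_\varnothing,0,0,\dots)$$ one has $\mathbf P^{(n)}=\mathcal C\,\mathbf m^{(n)}$. In particular the entries of $\mathcal C$ do not depend on $n$ (stability). -/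

import Mathlib

noncomputable section

namespace Koornwinder

/-! ### The rational functions entering the recursion -/

/-- The function `f(s|a,b,c,d)`, depending also on `t`. -/
def f (a b c d t s : ℂ) : ℂ :=
  ((1 - a * b * c * d * s / t) * (1 - t * s) * (1 - a * b * s) * (1 - a * c * s) *
      (1 - a * d * s) * (1 - b * c * s) * (1 - b * d * s) * (1 - c * d * s)) /
    ((1 - a * b * c * d * s ^ 2 / t) * (1 - a * b * c * d * s ^ 2) ^ 2 *
      (1 - a * b * c * d * t * s ^ 2))

/-- The function `g₁(s|a,b,c,d)`, depending also on `t`. -/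
def g₁ (a b c d t s : ℂ) : ℂ :=
  (a + b + c + d - (a * b * c + a * b * d + a * c * d + b * c * d) * s / t) /
      (1 - a * b * c * d * s ^ 2 / t ^ 2) *
    ((1 - s) / (1 - t))

/-- The function `g(s|a,b,c,d) = g₁(s|a,b,c,d) - g₁(st|a,b,c,d)`. -/
def g (a b c d t s : ℂ) : ℂ := g₁ a b c d t s - g₁ a b c d t (s * t)

/-- The conditions on the infinite matrix `C = (C i j)`, `i, j ≥ 0`: it is upper triangular with
ones on the diagonal and satisfies
`C i j = C (i-1) (j-1) + g(t^i) C i (j-1) + f(t^i) C (i+1) (j-1)` for all `i ≥ 0`, `j ≥ 1`,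
where entries with row index `-1` are zero. -/
structure IsTransitionMatrix (a b c d t : ℂ) (C : Matrix ℕ ℕ ℂ) : Prop where
  upper : ∀ i j, j < i → C i j = 0
  diag : ∀ i, C i i = 1
  rec_zero : ∀ j, C 0 (j + 1) =
    g a b c d t (t ^ 0) * C 0 j + f a b c d t (t ^ 0) * C 1 j
  rec_succ : ∀ i j, C (i + 1) (j + 1) =
    C i j + g a b c d t (t ^ (i + 1)) * C (i + 1) j + f a b c d t (t ^ (i + 1)) * C (i + 2) j

/-! ### Laurent polynomials and orbit sums -/

/-- The ring `ℂ[x₁^{±1}, …, xₙ^{±1}]` of Laurent polynomials, as the group algebra of `ℤⁿ`. -/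
abbrev Laurent (n : ℕ) : Type := AddMonoidAlgebra ℂ (Fin n → ℤ)

/-- The field `ℂ(x₁, …, xₙ)`, as the field of fractions of the Laurent polynomials. -/
abbrev RatFun (n : ℕ) : Type := FractionRing (Laurent n)

/-- The orbit of the exponent `μ ∈ ℤⁿ` under the hyperoctahedral group `{±1}ⁿ ⋊ 𝔖ₙ`, which acts
by permuting the coordinates and changing their signs. -/
def orbit {n : ℕ} (μ : Fin n → ℤ) : Finset (Fin n → ℤ) :=
  Finset.univ.image fun w : Equiv.Perm (Fin n) × (Fin n → ℤˣ) =>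
    fun i => (w.2 i : ℤ) * μ (w.1 i)

/-- The monomial symmetric Laurent polynomial `m_μ`: the sum of the distinct monomials in the
orbit of `x^μ` under the hyperoctahedral group. -/
def m {n : ℕ} (μ : Fin n → ℕ) : Laurent n :=
  ∑ ν ∈ orbit (fun i => (μ i : ℤ)), AddMonoidAlgebra.single ν 1

/-- The dominance order of type `BCₙ`: `μ₁ + ⋯ + μ_k ≤ lam₁ + ⋯ + lam_k` for all `k ≤ n`
(the total sizes may differ). -/
def Dominated {n : ℕ} (μ lam : Fin n → ℕ) : Prop :=
  ∀ k : Fin n, ∑ i ∈ Finset.Iic k, μ i ≤ ∑ i ∈ Finset.Iic k, lam i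

/-- The one column partition `(1^r)`, as a sequence of length `n`. -/
def column (n r : ℕ) : Fin n → ℕ := fun i => if (i : ℕ) < r then 1 else 0

/-! ### Koornwinder's operator -/

/-- The `u`-shift `x_i ↦ u x_i` on Laurent polynomials. -/
def shift {n : ℕ} (u : ℂ) (i : Fin n) (P : Laurent n) : Laurent n :=
  ∑ μ ∈ P.coeff.support, AddMonoidAlgebra.single μ (u ^ μ i * P.coeff μ)

/-- A constant, as a rational function. -/
def const (n : ℕ) (z : ℂ) : RatFun n := algebraMap ℂ (RatFun n) z

/-- A Laurent polynomial, as a rational function. -/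
def toRat {n : ℕ} (P : Laurent n) : RatFun n := algebraMap (Laurent n) (RatFun n) P

/-- The variable `x_i`, as a rational function. -/
def x {n : ℕ} (i : Fin n) : RatFun n :=
  toRat (AddMonoidAlgebra.single (Pi.single i 1) 1)

/-- The coefficient of `T_{q,x_i} - 1` in Koornwinder's operator, with `y` in place of `x_i`
(`y = x_i`, respectively `y = 1 / x_i` for the coefficient of `T_{q,x_i}⁻¹ - 1`). -/
def opCoeff (a b c d q t α : ℂ) {n : ℕ} (i : Fin n) (y : RatFun n) : RatFun n :=
  ((1 - const n a * y) * (1 - const n b * y) * (1 - const n c * y) * (1 - const n d * y)) /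
      (const n α * const n t ^ (n - 1) * (1 - y ^ 2) * (1 - const n q * y ^ 2)) *
    ∏ j ∈ Finset.univ.erase i,
      ((1 - const n t * y * x j) * (1 - const n t * (y / x j))) /
        ((1 - y * x j) * (1 - y / x j))

/-- Koornwinder's `q`-difference operator
`𝒟 = ∑ᵢ Φᵢ(x) (T_{q,x_i} - 1) + ∑ᵢ Φᵢ(1/x) (T_{q,x_i}⁻¹ - 1)`; here `α` is a square root of
`abcd/q`. -/
def op (a b c d q t α : ℂ) {n : ℕ} (P : Laurent n) : RatFun n :=
  ∑ i, opCoeff a b c d q t α i (x i) * toRat (shift q i P - P) +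
    ∑ i, opCoeff a b c d q t α i (1 / x i) * toRat (shift q⁻¹ i P - P)

/-- `⟨y; z⟩ = y + y⁻¹ - z - z⁻¹`. -/
def bracket (y z : ℂ) : ℂ := y + y⁻¹ - z - z⁻¹

/-- The eigenvalue `∑ⱼ ⟨α t^{n-j} q^{lam_j}; α t^{n-j}⟩`, the sum being over `1 ≤ j ≤ n`. -/
def eigenvalue (q t α : ℂ) {n : ℕ} (lam : Fin n → ℕ) : ℂ :=
  ∑ j : Fin n, bracket (α * t ^ (n - 1 - (j : ℕ)) * q ^ lam j) (α * t ^ (n - 1 - (j : ℕ)))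

/-! ### Koornwinder polynomials -/

/-- The characterization of the Koornwinder polynomial `P_lam(x|a,b,c,d|q,t)`: it is `m_lam` plus
a linear combination of the `m_μ` with `μ` a partition strictly below `lam` in the dominance order
(so it is in particular invariant under the hyperoctahedral group), and it is an eigenfunction of
Koornwinder's operator for the eigenvalue attached to `lam`. -/
structure IsKoornwinder (a b c d q t α : ℂ) {n : ℕ} (lam : Fin n → ℕ) (P : Laurent n) : Prop where
  triangular : P - m lam ∈ Submodule.span ℂ
    {Q | ∃ μ : Fin n → ℕ, Antitone μ ∧ Dominated μ lam ∧ μ ≠ lam ∧ Q = m μ}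
  eigen : op a b c d q t α P = const n (eigenvalue q t α lam) * toRat P

open Classical in
/-- The Koornwinder polynomial `P_lam(x|a,b,c,d|q,t)` (zero, if the conditions above do not
determine it uniquely). -/
def koornwinder (a b c d q t α : ℂ) {n : ℕ} (lam : Fin n → ℕ) : Laurent n :=
  if h : ∃! P, IsKoornwinder a b c d q t α lam P then h.choose else 0

/-- The infinite column vector `(P_{(1^n)}, P_{(1^{n-1})}, …, P_{(1)}, P_∅, 0, …)`. -/
def vecP (a b c d q t α : ℂ) (n : ℕ) : ℕ → Laurent n := fun i =>
  if i ≤ n then koornwinder a b c d q t α (column n (n - i)) else 0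

/-- The infinite column vector `(m_{(1^n)}, m_{(1^{n-1})}, …, m_{(1)}, m_∅, 0, …)`. -/
def vecm (n : ℕ) : ℕ → Laurent n := fun i => if i ≤ n then m (column n (n - i)) else 0

end Koornwinder

end

/-! The proof compares two operators on the kernel `genFun n Y` = ∏ᵢ (Y + xᵢ + 1/xᵢ). Expanding it
in powers of Y gives the column orbit sums: Σⱼ Y^j m_{(1^{n-j})} (`genFun_eq_sum`). Let p_k be the
monic polynomials whose three-term recurrence has coefficients g(t^k) and f(t^k). The recursion
defining C says precisely that Y^j = Σᵢ C_{ij} p_i(Y), so the kernel also equals Σ_k p_k(Y) v_k with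
v = C m (`genFun_eq_sum_columnVector`). It remains to see that the v_k are eigenvectors of
Koornwinder's operator.

The p_k are the monic Askey–Wilson polynomials in base t, in the variable Y = -(z + 1/z). They are
expanded in a basis on which the Askey–Wilson operator is bidiagonal (`awOp_awBasis`); the explicit
coefficients satisfy both the eigenvalue equation (`awCoeff_mul_eigenvalue_sub`) and the three-term
recurrence (`awEntry_rec`).

Koornwinder's operator in x acts on the kernel, up to a constant factor and a multiple of the
kernel, as the Askey–Wilson operator in Y (`op_genFun`). Indeed, at the node Y = -(xᵢ + 1/xᵢ) the
kernel vanishes, only the shifted terms of the Askey–Wilson operator survive, and these match the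
i-th terms of Koornwinder's operator (`koornwinder_term`); Lagrange interpolation at the n nodes
then gives the identity for all Y. Comparing coefficients of p_k(Y) yields the eigenvalue equation
for v_k (`op_columnVector`).

Since C is unitriangular, v_{n-r} is m_{(1^r)} plus shorter columns, which are exactly the
partitions below (1^r). The genericity assumptions make the eigenvalues of different columns
distinct, whence uniqueness (`IsKoornwinder.eq_columnVector`). Stability holds because the p_k do
not involve n. -/

noncomputable section
namespace Koornwinder
open Polynomial

/-! ### The transition matrix of a three-term recurrence -/

/-- The monic polynomials with `p (i + 1) = (X - g i) * p i - f (i - 1) * p (i - 1)`. -/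
def threeTerm (g f : ℕ → ℂ) : ℕ → ℂ[X]
  | 0 => 1
  | 1 => X - C (g 0)
  | i + 2 => (X - C (g (i + 1))) * threeTerm g f (i + 1) - C (f i) * threeTerm g f i

lemma threeTerm_monic_natDegree (g f : ℕ → ℂ) (i : ℕ) :
    (threeTerm g f i).Monic ∧ (threeTerm g f i).natDegree = i := by
  induction i using Nat.strong_induction_on with
  | _ i ih =>
    match i with
    | 0 => simp [threeTerm]
    | 1 => exact ⟨monic_X_sub_C _, natDegree_X_sub_C _⟩
    | i + 2 =>
      obtain ⟨hm, hd⟩ := ih (i + 1) (by omega)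
      obtain ⟨hm', hd'⟩ := ih i (by omega)
      have hmul : ((X - C (g (i + 1))) * threeTerm g f (i + 1)).Monic :=
        (monic_X_sub_C _).mul hm
      have hdeg : ((X - C (g (i + 1))) * threeTerm g f (i + 1)).natDegree = i + 2 := by
        rw [(monic_X_sub_C _).natDegree_mul hm, natDegree_X_sub_C, hd]; omega
      have hlt : (C (f i) * threeTerm g f i).natDegree <
          ((X - C (g (i + 1))) * threeTerm g f (i + 1)).natDegree := by
        rw [hdeg]
        have := natDegree_C_mul_le (f i) (threeTerm g f i)
        omega
      exact ⟨hmul.sub_of_left (degree_lt_degree hlt), by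
        rw [threeTerm, natDegree_sub_eq_left_of_natDegree_lt hlt, hdeg]⟩

variable {a b c d t : ℂ}

/-- The `j`-th column of the transition matrix. -/
def transitionColumn (g f : ℕ → ℂ) : ℕ → ℕ → ℂ
  | 0, i => if i = 0 then 1 else 0
  | j + 1, 0 => g 0 * transitionColumn g f j 0 + f 0 * transitionColumn g f j 1
  | j + 1, i + 1 => transitionColumn g f j i + g (i + 1) * transitionColumn g f j (i + 1) +
      f (i + 1) * transitionColumn g f j (i + 2)

lemma transitionColumn_upper (g f : ℕ → ℂ) (j i : ℕ) (h : j < i) :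
    transitionColumn g f j i = 0 := by
  induction j generalizing i with
  | zero => simp [transitionColumn, show i ≠ 0 by omega]
  | succ j ih =>
    obtain ⟨i, rfl⟩ : ∃ k, i = k + 1 := ⟨i - 1, by omega⟩
    simp [transitionColumn, ih i (by omega), ih (i + 1) (by omega), ih (i + 2) (by omega)]

lemma transitionColumn_diag (g f : ℕ → ℂ) (i : ℕ) : transitionColumn g f i i = 1 := by
  induction i with
  | zero => simp [transitionColumn]
  | succ i ih =>
    simp [transitionColumn, ih, transitionColumn_upper g f i (i + 1) (by omega),
      transitionColumn_upper g f i (i + 2) (by omega)]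

/-- Column 0 is forced by triangularity and the unit diagonal, and the recursion computes each
column from the previous one; in later columns the shape is automatic. -/
lemma existsUnique_isTransitionMatrix (a b c d t : ℂ) :
    ∃! M : Matrix ℕ ℕ ℂ, IsTransitionMatrix a b c d t M := by
  refine ⟨fun i j => transitionColumn (fun i => g a b c d t (t ^ i))
    (fun i => f a b c d t (t ^ i)) j i, ⟨?_, ?_, ?_, ?_⟩, ?_⟩
  · exact fun i j h => transitionColumn_upper _ _ _ _ h
  · exact fun i => transitionColumn_diag _ _ _
  · exact fun j => rfl
  · exact fun i j => rfl
  · intro M hM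
    have key : ∀ j i, M i j = transitionColumn (fun i => g a b c d t (t ^ i))
        (fun i => f a b c d t (t ^ i)) j i := by
      intro j
      induction j with
      | zero =>
        intro i
        rcases Nat.eq_zero_or_pos i with rfl | hi
        · simp [transitionColumn, hM.diag]
        · simp [transitionColumn, hM.upper i 0 hi, hi.ne']
      | succ j ih =>
        intro i
        cases i with
        | zero => rw [hM.rec_zero, transitionColumn, ih, ih]
        | succ i => rw [hM.rec_succ, transitionColumn, ih, ih, ih]
    ext i j
    exact key j i

/-- The polynomials attached to the recurrence coefficients `g(t^i)` and `f(t^i)`. -/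
abbrev recPoly (a b c d t : ℂ) : ℕ → ℂ[X] :=
  threeTerm (fun i => g a b c d t (t ^ i)) (fun i => f a b c d t (t ^ i))

/-- The recursion for the columns is multiplication by X written in the basis p_i. The bound N is
free because the entries with i > j vanish; the induction needs this slack. -/
lemma IsTransitionMatrix.X_pow_eq_sum {M : Matrix ℕ ℕ ℂ} (hM : IsTransitionMatrix a b c d t M)
    (j N : ℕ) (hN : j < N) :
    (X : ℂ[X]) ^ j = ∑ i ∈ Finset.range N, C (M i j) * recPoly a b c d t i := by
  induction j generalizing N with
  | zero =>
    obtain ⟨N, rfl⟩ : ∃ k, N = k + 1 := ⟨N - 1, by omega⟩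
    rw [Finset.sum_range_succ', Finset.sum_eq_zero]
    · simp [hM.diag, threeTerm]
    · intro i _
      simp [hM.upper (i + 1) 0 (by omega)]
  | succ j ih =>
    obtain ⟨N, rfl⟩ : ∃ k, N = k + 2 := ⟨N - 2, by omega⟩
    have hX : ∀ i, X * recPoly a b c d t (i + 1) = recPoly a b c d t (i + 2) +
        C (g a b c d t (t ^ (i + 1))) * recPoly a b c d t (i + 1) +
        C (f a b c d t (t ^ i)) * recPoly a b c d t i := by
      intro i; simp only [recPoly, threeTerm]; ring
    have hX0 : X * recPoly a b c d t 0 = recPoly a b c d t 1 +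
        C (g a b c d t (t ^ 0)) * recPoly a b c d t 0 := by
      simp only [recPoly, threeTerm]; ring
    have hz : M (N + 2) j = 0 := hM.upper _ _ (by omega)
    have hz' : M (N + 1) j = 0 := hM.upper _ _ (by omega)
    rw [pow_succ', ih (N + 1) (by omega), Finset.mul_sum, Finset.sum_range_succ',
      Finset.sum_range_succ' _ (N + 1)]
    simp only [mul_left_comm X, hX, hX0, hM.rec_zero, hM.rec_succ, map_add, map_mul, add_mul,
      mul_add, Finset.sum_add_distrib]
    have e1 := Finset.sum_range_succ (fun i => C (M i j) * recPoly a b c d t (i + 1)) N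
    have e2 := Finset.sum_range_succ' (fun i => C (M i j) * recPoly a b c d t (i + 1)) N
    have e3 := Finset.sum_range_succ
      (fun i => C (g a b c d t (t ^ (i + 1))) * C (M (i + 1) j) * recPoly a b c d t (i + 1)) N
    have e4 := Finset.sum_range_succ'
      (fun i => C (f a b c d t (t ^ i)) * C (M (i + 1) j) * recPoly a b c d t i) N
    have e5 := Finset.sum_range_succ
      (fun i => C (f a b c d t (t ^ i)) * C (M (i + 1) j) * recPoly a b c d t i) N
    have e6 := Finset.sum_range_succ
      (fun i => C (f a b c d t (t ^ (i + 1))) * C (M (i + 2) j) * recPoly a b c d t (i + 1)) N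
    rw [e1] at e2
    rw [e4] at e5
    have c1 : ∀ i, C (M (i + 1) j) * (C (f a b c d t (t ^ i)) * recPoly a b c d t i) =
      C (f a b c d t (t ^ i)) * C (M (i + 1) j) * recPoly a b c d t i := fun i => by ring
    have c2 : ∀ i, C (M (i + 1) j) * (C (g a b c d t (t ^ (i + 1))) * recPoly a b c d t (i + 1)) =
      C (g a b c d t (t ^ (i + 1))) * C (M (i + 1) j) * recPoly a b c d t (i + 1) :=
      fun i => by ring
    simp only [c1, c2, e1, e3, e6]
    simp only [hz, hz', map_zero, mul_zero, zero_mul, add_zero] at e2 e5 ⊢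
    linear_combination -e2 - e5

end Koornwinder
end

noncomputable section
namespace Koornwinder
open Polynomial

/-! ### The Askey–Wilson difference equation -/

section Field

variable {K : Type*} [Field K]

/-- The basis `∏_{j < k} (Z + a t^j + 1 / (a t^j))` adapted to the Askey–Wilson operator. -/
def awBasis (a t : K) (k : ℕ) (Z : K) : K :=
  ∏ j ∈ Finset.range k, (Z + a * t ^ j + (a * t ^ j)⁻¹)

/-- The coefficient of the Askey–Wilson operator in base `t`. -/
def awWeight (a b c d t z : K) : K :=
  (1 - a * z) * (1 - b * z) * (1 - c * z) * (1 - d * z) / ((1 - z ^ 2) * (1 - t * z ^ 2))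

/-- The eigenvalues of the Askey–Wilson operator in base `t`, with `A = abcd`. -/
def awEigenvalue (A t : K) (k : ℕ) : K := (1 - t ^ k) * (1 - A * t ^ k / t) / t ^ k

/-- The lowering coefficient of the Askey–Wilson operator on `awBasis`. -/
def awLower (a b c d t : K) (k : ℕ) : K :=
  -((1 - t ^ k) * (1 - a * b * t ^ k / t) * (1 - a * c * t ^ k / t) * (1 - a * d * t ^ k / t) * t /
    (a * (t ^ k) ^ 2))

/-- The Askey–Wilson operator on functions of `Z = -(z + 1/z)`. -/
def awOp (a b c d t : K) (φ : K → K) (z : K) : K :=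
  awWeight a b c d t z * (φ (-(t * z + (t * z)⁻¹)) - φ (-(z + z⁻¹))) +
    awWeight a b c d t z⁻¹ * (φ (-(t * z⁻¹ + (t * z⁻¹)⁻¹)) - φ (-(z + z⁻¹)))

lemma awBasis_succ (a t : K) (k : ℕ) (Z : K) :
    awBasis a t (k + 1) Z = awBasis a t k Z * (Z + a * t ^ k + (a * t ^ k)⁻¹) :=
  Finset.prod_range_succ _ _

/-- At Z = -(w + 1/w) the j-th factor is (1 - a t^j w)(1 - a t^j / w) / (a t^j). Replacing w = z by
tz moves one product a step forward and the other a step back, so all but boundary factors agree. -/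
lemma awBasis_shift {a t z : K} (ha : a ≠ 0) (ht : t ≠ 0) (hz : z ≠ 0) (k : ℕ) :
    (1 - a * z) * awBasis a t (k + 1) (-(t * z + (t * z)⁻¹)) =
      awBasis a t k (-(z + z⁻¹)) *
        ((1 - a * t ^ k * z) * (1 - a * t ^ k * t * z) * (1 - a / (t * z)) / (a * t ^ k)) := by
  induction k with
  | zero => simp [awBasis]; field_simp; ring
  | succ k ih =>
    rw [awBasis_succ, ← mul_assoc, ih, awBasis_succ]
    have := pow_ne_zero k ht
    rw [pow_succ]
    field_simp
    ring

lemma awOp_awBasis {a b c d t z : K} (ha : a ≠ 0) (ht : t ≠ 0) (hz : z ≠ 0)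
    (h1 : z ^ 2 ≠ 1) (h2 : t * z ^ 2 ≠ 1) (h3 : z ^ 2 ≠ t) (k : ℕ) :
    awOp a b c d t (awBasis a t k) z =
      awEigenvalue (a * b * c * d) t k * awBasis a t k (-(z + z⁻¹)) +
        awLower a b c d t k * awBasis a t (k - 1) (-(z + z⁻¹)) := by
  cases k with
  -- `awLower` vanishes at k = 0, so the truncated index k - 1 does no harm.
  | zero => simp [awOp, awBasis, awEigenvalue, awLower]
  | succ k =>
    have s1 := awBasis_shift ha ht hz k
    have s2 := awBasis_shift ha ht (inv_ne_zero hz) k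
    rw [inv_inv, add_comm z⁻¹ z] at s2
    have hk := pow_ne_zero k ht
    have e1 : (1 : K) - z ^ 2 ≠ 0 := sub_ne_zero.2 h1.symm
    have e2 : (1 : K) - t * z ^ 2 ≠ 0 := sub_ne_zero.2 h2.symm
    have e2' : (1 : K) - z ^ 2 * t ≠ 0 := by rwa [mul_comm]
    have e3 : z ^ 2 - t ≠ 0 := sub_ne_zero.2 h3
    have e4 : z ^ 2 - 1 ≠ 0 := sub_ne_zero.2 h1
    have i1 : (1 : K) - z⁻¹ ^ 2 = (z ^ 2 - 1) / z ^ 2 := by field_simp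
    have i2 : (1 : K) - t * z⁻¹ ^ 2 = (z ^ 2 - t) / z ^ 2 := by field_simp
    -- Each half of the operator is a multiple of the basis element of index k, with 1 - t z² (or z²
    -- - t) already cancelled. The remaining poles at z² = 1 cancel in the sum of the halves.
    have w1 : awWeight a b c d t z * (awBasis a t (k + 1) (-(t * z + (t * z)⁻¹)) -
        awBasis a t (k + 1) (-(z + z⁻¹))) =
        -(awBasis a t k (-(z + z⁻¹)) * ((1 - t ^ k * t) / (t ^ k * t) *
          ((1 - b * z) * (1 - c * z) * (1 - d * z) * (1 - a * t ^ k * z) / (z * (1 - z ^ 2))))) := by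
      have : awWeight a b c d t z * (awBasis a t (k + 1) (-(t * z + (t * z)⁻¹)) -
        awBasis a t (k + 1) (-(z + z⁻¹))) =
        (1 - b * z) * (1 - c * z) * (1 - d * z) / ((1 - z ^ 2) * (1 - t * z ^ 2)) *
        ((1 - a * z) * awBasis a t (k + 1) (-(t * z + (t * z)⁻¹)) -
          (1 - a * z) * awBasis a t (k + 1) (-(z + z⁻¹))) := by
        rw [awWeight]; ring
      rw [this, s1, awBasis_succ]
      field_simp
      ring
    have w2 : awWeight a b c d t z⁻¹ * (awBasis a t (k + 1) (-(t * z⁻¹ + (t * z⁻¹)⁻¹)) -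
        awBasis a t (k + 1) (-(z + z⁻¹))) =
        -(awBasis a t k (-(z + z⁻¹)) * ((1 - t ^ k * t) / (t ^ k * t) *
          ((z - b) * (z - c) * (z - d) * (z - a * t ^ k) / (z * (z ^ 2 - 1))))) := by
      have : awWeight a b c d t z⁻¹ * (awBasis a t (k + 1) (-(t * z⁻¹ + (t * z⁻¹)⁻¹)) -
        awBasis a t (k + 1) (-(z + z⁻¹))) =
        (1 - b * z⁻¹) * (1 - c * z⁻¹) * (1 - d * z⁻¹) / ((1 - z⁻¹ ^ 2) * (1 - t * z⁻¹ ^ 2)) *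
        ((1 - a * z⁻¹) * awBasis a t (k + 1) (-(t * z⁻¹ + (t * z⁻¹)⁻¹)) -
          (1 - a * z⁻¹) * awBasis a t (k + 1) (-(z + z⁻¹))) := by
        rw [awWeight]; ring
      rw [this, s2, awBasis_succ, i1, i2]
      field_simp
      ring
    rw [awOp, w1, w2, awBasis_succ, awEigenvalue, awLower, pow_succ t k, Nat.add_sub_cancel]
    have e5 : z ^ 2 - 1 = -(1 - z ^ 2) := by ring
    rw [e5]
    field_simp
    ring

end Field

/-- One step of the expansion coefficients of the Askey–Wilson polynomials in `awBasis`, where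
`u = t^k`, `w = t^(l + 1)` and `u * w = t^(k + l + 1)`. -/
def awRatio (a b c d t u w : ℂ) : ℂ :=
  -((1 - u * w) * (1 - a * b * (u * w) / t) * (1 - a * c * (u * w) / t) *
      (1 - a * d * (u * w) / t) * (1 - a * b * c * d * u ^ 2 * w / t ^ 2)) /
    (a * u * (1 - w) * (1 - a * b * c * d * (u * w) ^ 2 / t ^ 3) *
      (1 - a * b * c * d * (u * w) ^ 2 / t ^ 2))

/-- The coefficient of the basis element of index `k` in the monic Askey–Wilson polynomial of
degree `k + l`. -/
def awCoeff (a b c d t : ℂ) (k l : ℕ) : ℂ :=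
  ∏ r ∈ Finset.range l, awRatio a b c d t (t ^ k) (t ^ (r + 1))

/-- The coefficient `awCoeff`, indexed by the degree `i`. -/
def awEntry (a b c d t : ℂ) (i k : ℕ) : ℂ := if k ≤ i then awCoeff a b c d t k (i - k) else 0

/-- The algebraic identity behind the three-term recurrence of Askey–Wilson polynomials. -/
lemma awRecurrence_aux {a b c d s t u : ℂ} (ha : a ≠ 0) (ht : t ≠ 0) (ht1 : 1 - t ≠ 0)
    (hu : u ≠ 0) (h1 : u - s * t ≠ 0) (h2 : t - a * b * c * d * s ^ 2 ≠ 0)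
    (h3 : 1 - a * b * c * d * s ^ 2 ≠ 0)
    (h4 : t ^ 2 - a * b * c * d * s * u ≠ 0) (h5 : t ^ 2 - a * b * c * d * s ^ 2 ≠ 0) :
    -((1 - s * t) * ((1 - a * b * s) * (1 - a * c * s) * (1 - a * d * s)) *
        (t - a * b * c * d * s * u)) /
      (a * (u - s * t) * (t - a * b * c * d * s ^ 2) * (1 - a * b * c * d * s ^ 2)) =
    -((1 - u) * ((t - a * b * u) * (t - a * c * u) * (t - a * d * u)) * s) /
        (a * u * (u - s * t) * (t ^ 2 - a * b * c * d * s * u)) -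
      (a * u + 1 / (a * u)) - 
      ((a + b + c + d - (a * b * c + a * b * d + a * c * d + b * c * d) * s / t) * t ^ 2 * (1 - s) /
        ((t ^ 2 - a * b * c * d * s ^ 2) * (1 - t)) -
       (a + b + c + d - (a * b * c + a * b * d + a * c * d + b * c * d) * s) * (1 - s * t) /
        ((1 - a * b * c * d * s ^ 2) * (1 - t))) +
      a * (u - s) * (t ^ 2 - a * b * c * d * s) * ((t - b * c * s) * (t - b * d * s) *
        (t - c * d * s)) /
      ((t ^ 2 - a * b * c * d * s * u) * (t ^ 2 - a * b * c * d * s ^ 2) *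
        (t - a * b * c * d * s ^ 2)) := by
  -- With s = t^(i+1) and u = t^k, this is the recurrence for the coefficient of index k, divided by
  -- its value in degree i + 1: in order, the ratios from degree i + 2, from index k - 1, from
  -- multiplication by Y, from g, and from f in degree i.
  generalize hD1 : u - s * t = D1 at *
  generalize hD2 : t - a * b * c * d * s ^ 2 = D2 at *
  generalize hD3 : 1 - a * b * c * d * s ^ 2 = D3 at *
  generalize hD4 : t ^ 2 - a * b * c * d * s * u = D4 at *
  generalize hD5 : t ^ 2 - a * b * c * d * s ^ 2 = D5 at *
  generalize hD6 : 1 - t = D6 at *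
  field_simp
  subst hD1 hD2 hD3 hD4 hD5 hD6
  ring

end Koornwinder
end

noncomputable section
namespace Koornwinder
open Polynomial

/-! ### Expansion of the recurrence polynomials in the Askey–Wilson basis -/

section Generic

variable {a b c d t : ℂ}

/-- The induction step for `awCoeff_mul_eigenvalue_sub`: raising the degree by one preserves the
eigenvalue equation between neighbouring coefficients. -/
lemma awRatio_mul_eigenvalue_sub {u w : ℂ} (A : ℂ) (hA : A = a * b * c * d) (ha : a ≠ 0) (ht : t ≠ 0)
    (hu : u ≠ 0) (hw0 : w ≠ 0) (hw : 1 - w ≠ 0) (hwt : 1 - w * t ≠ 0) :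
    awRatio a b c d t u (w * t) *
        ((1 - u * (w * t)) * (1 - A * (u * (w * t)) / t) / (u * (w * t)) -
          (1 - u) * (1 - A * u / t) / u) =
      ((1 - u * w) * (1 - A * (u * w) / t) / (u * w) - (1 - u) * (1 - A * u / t) / u) *
        awRatio a b c d t (u * t) w := by
  have e : u * t * w = u * (w * t) := by ring
  rw [awRatio, awRatio, e]
  generalize hD1 : 1 - w = D1 at *
  generalize hD2 : 1 - w * t = D2 at *
  generalize 1 - a * b * c * d * (u * (w * t)) ^ 2 / t ^ 3 = D3 at *
  generalize 1 - a * b * c * d * (u * (w * t)) ^ 2 / t ^ 2 = D4 at *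
  -- D3 and D4 occur identically on both sides, so their inverses form a common factor and need not
  -- be assumed meaningful.
  have e3 : ∀ N M : ℂ, N / (M * D3 * D4) = N / M * (D3⁻¹ * D4⁻¹) := fun N M => by
    rw [div_eq_mul_inv, mul_inv, mul_inv, div_eq_mul_inv]; ring
  rw [e3, e3]
  generalize D3⁻¹ * D4⁻¹ = z
  subst hA
  field_simp
  subst hD1 hD2
  ring

lemma awRatio_eq {u w s : ℂ} (ha : a ≠ 0) (ht : t ≠ 0) (hu : u ≠ 0) (huw : u * w = s * t) :
    awRatio a b c d t u w =
      -((1 - s * t) * ((1 - a * b * s) * (1 - a * c * s) * (1 - a * d * s)) *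
        (t - a * b * c * d * s * u)) /
      (a * (u - s * t) * (t - a * b * c * d * s ^ 2) * (1 - a * b * c * d * s ^ 2)) := by
  obtain rfl : w = s * t / u := by rw [← huw]; field_simp
  have e1 : u * (s * t / u) = s * t := by field_simp
  have e2 : a * u * (1 - s * t / u) = a * (u - s * t) := by field_simp
  have e3 : a * b * c * d * (s * t) ^ 2 / t ^ 3 = a * b * c * d * s ^ 2 / t := by field_simp
  have e4 : a * b * c * d * (s * t) ^ 2 / t ^ 2 = a * b * c * d * s ^ 2 := by field_simp
  have e5 : 1 - a * b * c * d * u ^ 2 * (s * t / u) / t ^ 2 = (t - a * b * c * d * s * u) / t := by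
    field_simp
  have e6 : 1 - a * b * c * d * s ^ 2 / t = (t - a * b * c * d * s ^ 2) / t := by field_simp
  have e7 : ∀ p, a * p * (s * t) / t = a * p * s := fun p => by field_simp
  rw [awRatio, e1, e2, e3, e4, e5, e6, e7, e7, e7]
  generalize t - a * b * c * d * s ^ 2 = D1
  generalize 1 - a * b * c * d * s ^ 2 = D2
  generalize u - s * t = D3
  rw [show a * D3 * (D1 / t) * D2 = (a * D3 * D1 * D2) / t by ring]
  rw [div_div_eq_mul_div]
  congr 1
  field_simp

lemma f_eq_awRatio_mul {u w s : ℂ} (ha : a ≠ 0) (ht : t ≠ 0) (hu : u ≠ 0) (hs : u * w = s * t)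
    (h1 : u - s * t ≠ 0) (h3 : 1 - a * b * c * d * s ^ 2 ≠ 0)
    (h2 : t - a * b * c * d * s ^ 2 ≠ 0) (h6 : 1 - a * b * c * d * (t * s ^ 2) ≠ 0)
    (h4 : t - a * b * c * d * s * u ≠ 0) :
    f a b c d t s = -(awRatio a b c d t u w * (a * (u - s * t) * (t ^ 2 - a * b * c * d * (s * t)) *
        ((t - b * c * (s * t)) * (t - b * d * (s * t)) * (t - c * d * (s * t))) /
      ((t ^ 2 - a * b * c * d * (s * t) * u) * (t ^ 2 - a * b * c * d * (s * t) ^ 2) *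
        (t - a * b * c * d * (s * t) ^ 2)))) := by
  rw [awRatio_eq ha ht hu hs, f]
  have e1 : t ^ 2 - a * b * c * d * (s * t) * u = t * (t - a * b * c * d * s * u) := by ring
  have e2 : t ^ 2 - a * b * c * d * (s * t) ^ 2 = t ^ 2 * (1 - a * b * c * d * s ^ 2) := by ring
  have e3 : t - a * b * c * d * (s * t) ^ 2 = t * (1 - a * b * c * d * (t * s ^ 2)) := by ring
  have e4 : 1 - a * b * c * d * s ^ 2 / t = (t - a * b * c * d * s ^ 2) / t := by field_simp
  have e5 : 1 - a * b * c * d * t * s ^ 2 = 1 - a * b * c * d * (t * s ^ 2) := by ring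
  have e6 : 1 - a * b * c * d * s / t = (t - a * b * c * d * s) / t := by field_simp
  rw [e1, e2, e3, e4, e5, e6]
  generalize u - s * t = D1 at *
  generalize t - a * b * c * d * s ^ 2 = D2 at *
  generalize 1 - a * b * c * d * s ^ 2 = D3 at *
  generalize 1 - a * b * c * d * (t * s ^ 2) = D4 at *
  generalize t - a * b * c * d * s * u = D5 at *
  field_simp

/-- Only t is inverted; the other denominators vanish on both sides simultaneously, so the identity
also covers abcd s² = t². -/
lemma g_eq {s : ℂ} (ht : t ≠ 0) :
    g a b c d t s =
      (a + b + c + d - (a * b * c + a * b * d + a * c * d + b * c * d) * s / t) * t ^ 2 * (1 - s) /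
        ((t ^ 2 - a * b * c * d * s ^ 2) * (1 - t)) -
       (a + b + c + d - (a * b * c + a * b * d + a * c * d + b * c * d) * s) * (1 - s * t) /
        ((1 - a * b * c * d * s ^ 2) * (1 - t)) := by
  have e1 : 1 - a * b * c * d * s ^ 2 / t ^ 2 = (t ^ 2 - a * b * c * d * s ^ 2) / t ^ 2 := by
    field_simp
  have e2 : a * b * c * d * (s * t) ^ 2 / t ^ 2 = a * b * c * d * s ^ 2 := by field_simp
  have e3 : (a * b * c + a * b * d + a * c * d + b * c * d) * (s * t) / t =
    (a * b * c + a * b * d + a * c * d + b * c * d) * s := by field_simp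
  rw [g, g₁, g₁, e1, e2, e3, div_div_eq_mul_div, div_mul_div_comm, div_mul_div_comm]

/-- Genericity of the parameters. -/
structure GenericParams (a b c d t : ℂ) : Prop where
  a_ne : a ≠ 0
  t_ne : t ≠ 0
  t_pow : ∀ k : ℕ, 1 ≤ k → t ^ k ≠ 1
  sub_ne : ∀ k : ℕ, t - a * b * c * d * t ^ k ≠ 0

namespace GenericParams

lemma pow_ne (h : GenericParams a b c d t) (k : ℕ) : t ^ k ≠ 0 := pow_ne_zero k h.t_ne

lemma one_sub_pow_ne (h : GenericParams a b c d t) (k : ℕ) : 1 - t ^ (k + 1) ≠ 0 :=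
  sub_ne_zero.2 (h.t_pow (k + 1) (by omega)).symm

lemma one_sub_ne (h : GenericParams a b c d t) (k : ℕ) : 1 - a * b * c * d * t ^ k ≠ 0 := by
  intro h0
  refine h.sub_ne (k + 1) ?_
  rw [pow_succ]
  linear_combination t * h0

lemma pow_sub_pow_ne (h : GenericParams a b c d t) (k l : ℕ) : t ^ k - t ^ (k + l + 1) ≠ 0 := by
  have : t ^ k - t ^ (k + l + 1) = t ^ k * (1 - t ^ (l + 1)) := by ring
  rw [this]
  exact mul_ne_zero (h.pow_ne k) (h.one_sub_pow_ne l)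

end GenericParams

/-- This is the coefficient of index k in the eigenvalue equation for degree k + l + 1, the operator
being bidiagonal. As `awCoeff` is a product over the degree with k fixed, the induction runs over l.
-/
lemma awCoeff_mul_eigenvalue_sub (h : GenericParams a b c d t) (k l : ℕ) :
    awCoeff a b c d t k (l + 1) * (awEigenvalue (a * b * c * d) t (k + l + 1) -
      awEigenvalue (a * b * c * d) t k) =
      awLower a b c d t (k + 1) * awCoeff a b c d t (k + 1) l := by
  have ha := h.a_ne
  have ht := h.t_ne
  have hk := h.pow_ne k
  induction l with
  | zero =>
    have h1 := h.one_sub_pow_ne 0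
    have h2 := h.one_sub_ne (2 * k)
    have h3 := h.sub_ne (2 * k)
    rw [mul_comm 2, pow_mul] at h2 h3
    have h4 : t ^ k - t ^ k * t ≠ 0 := by simpa [pow_succ] using h.pow_sub_pow_ne k 0
    simp only [awCoeff, Finset.prod_range_succ, Finset.prod_range_zero, one_mul, mul_one]
    rw [awRatio_eq (s := t ^ k) ha ht hk (by ring)]
    simp only [awEigenvalue, awLower, add_zero, pow_succ t k]
    generalize t ^ k = u at *
    have e1 : (1 - u * t) * (1 - a * b * c * d * (u * t) / t) / (u * t) -
      (1 - u) * (1 - a * b * c * d * u / t) / u =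
      (u - u * t) * (1 - a * b * c * d * u ^ 2) / (u ^ 2 * t) := by
      field_simp
      ring
    have e2 : t - a * b * c * d * u * u = t - a * b * c * d * u ^ 2 := by ring
    rw [e1, e2]
    generalize u - u * t = D1 at *
    generalize 1 - a * b * c * d * u ^ 2 = D2 at *
    generalize t - a * b * c * d * u ^ 2 = D3 at *
    field_simp
  | succ l ih =>
    have key := awRatio_mul_eigenvalue_sub (u := t ^ k) (w := t ^ (l + 1)) (a := a) (b := b)
      (c := c) (d := d) _ rfl ha ht hk (h.pow_ne _) (h.one_sub_pow_ne l)
      (by rw [← pow_succ]; exact h.one_sub_pow_ne (l + 1))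
    have e1 : awCoeff a b c d t k (l + 1 + 1) =
        awCoeff a b c d t k (l + 1) * awRatio a b c d t (t ^ k) (t ^ (l + 1) * t) := by
      rw [awCoeff, Finset.prod_range_succ, pow_succ t (l + 1)]; rfl
    have e2 : awCoeff a b c d t (k + 1) (l + 1) =
        awCoeff a b c d t (k + 1) l * awRatio a b c d t (t ^ k * t) (t ^ (l + 1)) := by
      rw [awCoeff, Finset.prod_range_succ, pow_succ t k]; rfl
    have e3 : t ^ (k + l + 1) = t ^ k * t ^ (l + 1) := by ring
    have e4 : t ^ (k + (l + 1) + 1) = t ^ k * (t ^ (l + 1) * t) := by ring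
    simp only [awEigenvalue, e3] at ih
    rw [e1, e2, awEigenvalue, e4, awEigenvalue]
    linear_combination (awCoeff a b c d t k (l + 1)) * key +
      awRatio a b c d t (t ^ k * t) (t ^ (l + 1)) * ih

/-- The coefficient below a given one in the expansion of an Askey–Wilson polynomial. -/
lemma awEntry_pred (h : GenericParams a b c d t) (k l : ℕ) :
    (if k = 0 then 0 else awCoeff a b c d t (k - 1) (l + 1)) =
      awCoeff a b c d t k l *
        (-((1 - t ^ k) * ((t - a * b * t ^ k) * (t - a * c * t ^ k) * (t - a * d * t ^ k)) *
            t ^ (k + l)) /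
          (a * t ^ k * (t ^ k - t ^ (k + l) * t) *
            (t ^ 2 - a * b * c * d * t ^ (k + l) * t ^ k))) := by
  cases k with
  | zero => simp
  | succ k =>
    have key := awCoeff_mul_eigenvalue_sub h k l
    have ha := h.a_ne
    have ht := h.t_ne
    have hk := h.pow_ne k
    have hl := h.pow_ne l
    have h1 := h.one_sub_pow_ne l
    have h2 := h.sub_ne (k + l + 1 + k)
    have h3 := h.pow_sub_pow_ne k l
    have h4 := h.pow_ne (k + l + 1)
    rw [if_neg (by omega), Nat.add_sub_cancel]
    simp only [awEigenvalue, awLower, pow_succ t k, show k + 1 + l = k + l + 1 by omega] at key ⊢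
    rw [pow_add t _ k, ← mul_assoc] at h2
    generalize awCoeff a b c d t k (l + 1) = x at *
    generalize awCoeff a b c d t (k + 1) l = y at *
    generalize t ^ (k + l + 1) = s at *
    generalize t ^ k = u at *
    have e1 : (1 - s) * (1 - a * b * c * d * s / t) / s -
        (1 - u) * (1 - a * b * c * d * u / t) / u =
        (u - s) * (t - a * b * c * d * s * u) / (s * u * t) := by
      field_simp
      ring
    have e2 : u * t - s * t = (u - s) * t := by ring
    have e3 : t ^ 2 - a * b * c * d * s * (u * t) = t * (t - a * b * c * d * s * u) := by ring
    rw [e1] at key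
    rw [e2, e3]
    generalize u - s = D1 at *
    generalize t - a * b * c * d * s * u = D2 at *
    -- The eigenvalue equation solved for the lower coefficient; genericity keeps the eigenvalue
    -- difference nonzero.
    have e4 : x = y * -((1 - u * t) * (1 - a * b * (u * t) / t) * (1 - a * c * (u * t) / t) *
        (1 - a * d * (u * t) / t) * t / (a * (u * t) ^ 2)) * (s * u * t) / (D1 * D2) := by
      rw [eq_div_iff (mul_ne_zero h3 h2)]
      field_simp at key ⊢
      linear_combination key
    rw [e4]
    field_simp

lemma awEntry_rec (h : GenericParams a b c d t) (i k : ℕ) :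
    awEntry a b c d t (i + 2) k = (if k = 0 then 0 else awEntry a b c d t (i + 1) (k - 1)) -
      (a * t ^ k + (a * t ^ k)⁻¹ + g a b c d t (t ^ (i + 1))) * awEntry a b c d t (i + 1) k -
      f a b c d t (t ^ i) * awEntry a b c d t i k := by
  have ha := h.a_ne
  have ht := h.t_ne
  have ht1 : 1 - t ≠ 0 := by simpa using h.one_sub_pow_ne 0
  have hk := h.pow_ne k
  rcases lt_or_ge (i + 2) k with hlt | hle
  · simp only [awEntry]
    rw [if_neg (by omega), if_neg (by omega), if_neg (by omega), if_neg (by omega),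
      if_neg (by omega)]
    simp
  rcases hle.eq_or_lt with rfl | hle
  · simp [awEntry, awCoeff]
  have hp1 : ∀ l, (if k = 0 then 0 else awEntry a b c d t (k + l) (k - 1)) =
      if k = 0 then 0 else awCoeff a b c d t (k - 1) (l + 1) := by
    intro l
    split_ifs with h0
    · rfl
    · rw [awEntry, if_pos (by omega), show k + l - (k - 1) = l + 1 by omega]
  have aux (m : ℕ) (hm : k + m = i + 1) := awRecurrence_aux (a := a) (b := b) (c := c) (d := d)
    (t := t) (s := t ^ (i + 1)) (u := t ^ k) ha ht ht1 hk
    (by rw [← hm, ← pow_succ]; exact h.pow_sub_pow_ne k m)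
    (by rw [← pow_mul]; exact h.sub_ne _) (by rw [← pow_mul]; exact h.one_sub_ne _)
    (by
      have := mul_ne_zero ht (h.sub_ne (i + k))
      rwa [show t * (t - a * b * c * d * t ^ (i + k)) =
        t ^ 2 - a * b * c * d * t ^ (i + 1) * t ^ k by ring] at this)
    (by
      have := mul_ne_zero (pow_ne_zero 2 ht) (h.one_sub_ne (2 * i))
      rwa [show t ^ 2 * (1 - a * b * c * d * t ^ (2 * i)) =
        t ^ 2 - a * b * c * d * (t ^ (i + 1)) ^ 2 by ring] at this)
  rw [g_eq ht]
  rcases Nat.lt_succ_iff.1 hle |>.eq_or_lt with rfl | hle'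
  -- At k = i + 1 the degree-i coefficient is zero; correspondingly the last term of
  -- `awRecurrence_aux` carries the factor u - s = 0.
  · have hz : awEntry a b c d t i (i + 1) = 0 := by simp [awEntry]
    have h2 : awEntry a b c d t (i + 2) (i + 1) = awRatio a b c d t (t ^ (i + 1)) t := by
      simp [awEntry, awCoeff, show i + 2 - (i + 1) = 1 by omega]
    have h1 : awEntry a b c d t (i + 1) (i + 1) = 1 := by simp [awEntry, awCoeff]
    have hp := hp1 0
    rw [awEntry_pred h] at hp
    rw [add_zero] at hp
    rw [hp, hz, h1, h2, awRatio_eq (s := t ^ (i + 1)) ha ht hk rfl, aux 0 rfl]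
    simp only [awCoeff, Finset.prod_range_zero, sub_self]
    ring
  · obtain ⟨m, rfl⟩ : ∃ m, i = k + m := ⟨i - k, by omega⟩
    have h0 : awEntry a b c d t (k + m) k = awCoeff a b c d t k m := by simp [awEntry]
    have h1 : awEntry a b c d t (k + m + 1) k =
        awCoeff a b c d t k m * awRatio a b c d t (t ^ k) (t ^ (m + 1)) := by
      rw [awEntry, if_pos (by omega), show k + m + 1 - k = m + 1 by omega, awCoeff,
        Finset.prod_range_succ]; rfl
    have h2 : awEntry a b c d t (k + m + 2) k =
        awEntry a b c d t (k + m + 1) k * awRatio a b c d t (t ^ k) (t ^ (m + 2)) := by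
      rw [awEntry, if_pos (by omega), show k + m + 2 - k = m + 2 by omega, awCoeff,
        Finset.prod_range_succ, awEntry, if_pos (by omega), show k + m + 1 - k = m + 1 by omega]
      rfl
    have hp := hp1 (m + 1)
    have h1' : awCoeff a b c d t k (m + 1) = awEntry a b c d t (k + m + 1) k := by
      rw [awEntry, if_pos (by omega), show k + m + 1 - k = m + 1 by omega]
    rw [awEntry_pred h, h1'] at hp
    have hf := f_eq_awRatio_mul (a := a) (b := b) (c := c) (d := d) (t := t) (u := t ^ k)
      (w := t ^ (m + 1)) (s := t ^ (k + m)) ha ht hk (by ring)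
      (by rw [← pow_succ]; exact h.pow_sub_pow_ne k m)
      (by rw [← pow_mul]; exact h.one_sub_ne _) (by rw [← pow_mul]; exact h.sub_ne _)
      (by rw [← pow_mul, ← pow_succ']; exact h.one_sub_ne _)
      (by rw [mul_assoc _ (t ^ (k + m)), ← pow_add]; exact h.sub_ne _)
    rw [← pow_succ] at hf
    rw [show k + m + 1 = k + (m + 1) by omega] at *
    rw [hp, h2, hf, h0, awRatio_eq (s := t ^ (k + (m + 1))) ha ht hk (by ring), aux (m + 1) rfl, h1]
    ring

end Generic

end Koornwinder
end

/-! ### Recurrence polynomials as eigenfunctions of the Askey–Wilson operator -/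

noncomputable section
namespace Koornwinder
open Polynomial

variable {a b c d t : ℂ}

/-- The polynomial version of `awBasis`. -/
def awPoly (a t : ℂ) (k : ℕ) : ℂ[X] :=
  ∏ j ∈ Finset.range k, (X + C (a * t ^ j + (a * t ^ j)⁻¹))

lemma awPoly_succ (a t : ℂ) (k : ℕ) :
    awPoly a t (k + 1) = awPoly a t k * (X + C (a * t ^ k + (a * t ^ k)⁻¹)) :=
  Finset.prod_range_succ _ _

lemma aeval_awPoly {K : Type*} [Field K] [Algebra ℂ K] (a t : ℂ) (k : ℕ) (Z : K) :
    aeval Z (awPoly a t k) = awBasis (algebraMap ℂ K a) (algebraMap ℂ K t) k Z := by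
  simp [awPoly, awBasis, add_assoc]

lemma recPoly_eq_sum (h : GenericParams a b c d t) (i N : ℕ) (hN : i < N) :
    recPoly a b c d t i = ∑ k ∈ Finset.range N, C (awEntry a b c d t i k) * awPoly a t k := by
  induction i using Nat.strong_induction_on generalizing N with
  | _ i ih =>
    match i with
    | 0 =>
      obtain ⟨N, rfl⟩ : ∃ M, N = M + 1 := ⟨N - 1, by omega⟩
      rw [Finset.sum_range_succ', Finset.sum_eq_zero]
      · simp [awEntry, awCoeff, threeTerm, awPoly]
      · intro k _; simp [awEntry]
    | 1 =>
      obtain ⟨N, rfl⟩ : ∃ M, N = M + 2 := ⟨N - 2, by omega⟩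
      rw [Finset.sum_range_succ', Finset.sum_range_succ', Finset.sum_eq_zero]
      · have ha := h.a_ne
        have ht := h.t_ne
        have ht1 : 1 - t ≠ 0 := by simpa using h.one_sub_pow_ne 0
        have e0 : awEntry a b c d t 1 0 = -(a + a⁻¹ + g a b c d t (t ^ 0)) := by
          have h1 : 1 - a * b * c * d ≠ 0 := by simpa using h.one_sub_ne 0
          have h2 : t - a * b * c * d ≠ 0 := by simpa using h.sub_ne 0
          have := awRatio_eq (a := a) (b := b) (c := c) (d := d) (t := t) (u := 1) (w := t) (s := 1)
            ha ht one_ne_zero rfl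
          simp only [awEntry, awCoeff, Finset.prod_range_succ, Finset.prod_range_zero, pow_zero,
            zero_add, pow_one, one_mul, Nat.sub_zero, zero_le, if_true]
          rw [this, g_eq ht]
          -- At s = 1 the first fraction of g has numerator 0, so it drops out even when abcd = t²
          -- annihilates its denominator.
          simp only [one_pow, mul_one, one_mul, sub_self, mul_zero, zero_div]
          generalize hD : 1 - a * b * c * d = D at *
          generalize 1 - t = D' at *
          generalize t - a * b * c * d = D'' at *
          field_simp
          subst hD
          ring
        have e1 : awEntry a b c d t 1 1 = 1 := by simp [awEntry, awCoeff]
        rw [e0, e1]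
        simp only [threeTerm, awPoly, zero_add, Finset.prod_range_succ, Finset.prod_range_zero,
          pow_zero, mul_one, map_neg, map_add, map_one]
        ring
      · intro k _; simp [awEntry]
    | i + 2 =>
      obtain ⟨N, rfl⟩ : ∃ M, N = M + 1 := ⟨N - 1, by omega⟩
      have h1 := ih (i + 1) (by omega) (N + 1) (by omega)
      have h0 := ih i (by omega) (N + 1) (by omega)
      -- X times the k-th basis polynomial is the next one minus (a t^k + 1/(a t^k)) times itself.
      have hX : X * recPoly a b c d t (i + 1) = ∑ k ∈ Finset.range (N + 1),
          (C (if k = 0 then 0 else awEntry a b c d t (i + 1) (k - 1)) * awPoly a t k -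
            C (a * t ^ k + (a * t ^ k)⁻¹) * C (awEntry a b c d t (i + 1) k) * awPoly a t k) := by
        have hz : awEntry a b c d t (i + 1) N = 0 := by
          rw [awEntry, if_neg (by omega)]
        rw [Finset.sum_sub_distrib, Finset.sum_range_succ', Finset.sum_range_succ, hz,
          ih (i + 1) (by omega) N (by omega), Finset.mul_sum]
        simp only [Nat.add_sub_cancel, if_true, map_zero, zero_mul, mul_zero, add_zero,
          Nat.succ_ne_zero, if_false, awPoly_succ]
        rw [← Finset.sum_sub_distrib]
        exact Finset.sum_congr rfl fun k _ => by ring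
      have : recPoly a b c d t (i + 2) = X * recPoly a b c d t (i + 1) -
          C (g a b c d t (t ^ (i + 1))) * recPoly a b c d t (i + 1) -
          C (f a b c d t (t ^ i)) * recPoly a b c d t i := by
        simp only [recPoly, threeTerm]; ring
      rw [this, hX, h1, h0, Finset.mul_sum, Finset.mul_sum, ← Finset.sum_sub_distrib,
        ← Finset.sum_sub_distrib]
      refine Finset.sum_congr rfl fun k _ => ?_
      rw [awEntry_rec h]
      simp only [map_sub, map_mul, map_add]
      ring

section Field

variable {K : Type*} [Field K]

lemma awOp_sum (a b c d t : K) {ι : Type*} (s : Finset ι) (r : ι → K) (φ : ι → K → K) (z : K) :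
    awOp a b c d t (fun Z => ∑ k ∈ s, r k * φ k Z) z =
      ∑ k ∈ s, r k * awOp a b c d t (φ k) z := by
  simp only [awOp]
  rw [← Finset.sum_sub_distrib, ← Finset.sum_sub_distrib, Finset.mul_sum, Finset.mul_sum,
    ← Finset.sum_add_distrib]
  exact Finset.sum_congr rfl fun k _ => by ring

/-- The recurrence polynomials are eigenfunctions of the Askey–Wilson operator. -/
lemma awOp_recPoly [Algebra ℂ K] (h : GenericParams a b c d t) {z : K} (hz : z ≠ 0)
    (h1 : z ^ 2 ≠ 1) (h2 : algebraMap ℂ K t * z ^ 2 ≠ 1) (h3 : z ^ 2 ≠ algebraMap ℂ K t) (i : ℕ) :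
    awOp (algebraMap ℂ K a) (algebraMap ℂ K b) (algebraMap ℂ K c) (algebraMap ℂ K d)
        (algebraMap ℂ K t) (fun Z => aeval Z (recPoly a b c d t i)) z =
      algebraMap ℂ K (awEigenvalue (a * b * c * d) t i) *
        aeval (-(z + z⁻¹)) (recPoly a b c d t i) := by
  have ha : algebraMap ℂ K a ≠ 0 := (_root_.map_ne_zero _).2 h.a_ne
  have ht : algebraMap ℂ K t ≠ 0 := (_root_.map_ne_zero _).2 h.t_ne
  have hE : ∀ k, awEigenvalue (algebraMap ℂ K a * algebraMap ℂ K b * algebraMap ℂ K c *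
      algebraMap ℂ K d) (algebraMap ℂ K t) k =
      algebraMap ℂ K (awEigenvalue (a * b * c * d) t k) := by
    intro k; simp [awEigenvalue]
  have hL : ∀ k, awLower (algebraMap ℂ K a) (algebraMap ℂ K b) (algebraMap ℂ K c)
      (algebraMap ℂ K d) (algebraMap ℂ K t) k = algebraMap ℂ K (awLower a b c d t k) := by
    intro k; simp [awLower]
  simp only [recPoly_eq_sum h i (i + 1) (Nat.lt_succ_self i), map_sum, map_mul, aeval_C,
    aeval_awPoly]
  rw [awOp_sum]
  simp only [awOp_awBasis ha ht hz h1 h2 h3, hE, hL, mul_add, Finset.mul_sum]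
  rw [Finset.sum_add_distrib, Finset.sum_range_succ _ i, Finset.sum_range_succ' _ i,
    Finset.sum_range_succ _ i]
  have hl0 : awLower a b c d t 0 = 0 := by simp [awLower]
  rw [hl0]
  simp only [Nat.add_sub_cancel, map_zero, zero_mul, mul_zero, add_zero]
  rw [add_right_comm, ← Finset.sum_add_distrib]
  congr 1
  -- Below the top index, the diagonal term and the lowering term from k + 1 combine by the
  -- eigenvalue equation.
  · refine Finset.sum_congr rfl fun k hk => ?_
    have hk := Finset.mem_range.1 hk
    obtain ⟨l, rfl⟩ : ∃ l, i = k + l + 1 := ⟨i - k - 1, by omega⟩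
    have key := congrArg (algebraMap ℂ K) (awCoeff_mul_eigenvalue_sub h k l)
    have e1 : awEntry a b c d t (k + l + 1) k = awCoeff a b c d t k (l + 1) := by
      rw [awEntry, if_pos (by omega), show k + l + 1 - k = l + 1 by omega]
    have e2 : awEntry a b c d t (k + l + 1) (k + 1) = awCoeff a b c d t (k + 1) l := by
      rw [awEntry, if_pos (by omega), show k + l + 1 - (k + 1) = l by omega]
    rw [e1, e2]
    simp only [map_mul, map_sub] at key
    linear_combination -(awBasis (algebraMap ℂ K a) (algebraMap ℂ K t) k (-(z + z⁻¹))) * key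
  · ring

end Field

end Koornwinder
end

noncomputable section
namespace Koornwinder
open Polynomial

/-! ### Partial fractions -/

section Field

variable {K : Type*} [Field K]

/-- Lagrange interpolation at `n` nodes for a polynomial of degree at most `n`. -/
lemma sum_eval_mul_prod_div {n : ℕ} (G : K[X]) (hG : G.natDegree ≤ n) {v : Fin n → K}
    (hv : Function.Injective v) (Y : K) :
    ∑ i, G.eval (v i) * ∏ j ∈ Finset.univ.erase i, (Y - v j) / (v i - v j) =
      G.eval Y - G.coeff n * ∏ j, (Y - v j) := by
  -- Subtracting the right multiple of the nodal polynomial lowers the degree below n without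
  -- changing the values at the nodes.
  set H := G - C (G.coeff n) * Lagrange.nodal Finset.univ v with hH
  have hN : (Lagrange.nodal Finset.univ v).natDegree = n := by
    rw [Lagrange.natDegree_nodal, Finset.card_univ, Fintype.card_fin]
  have hNc : (Lagrange.nodal Finset.univ v).coeff n = 1 := by
    have : (Lagrange.nodal Finset.univ v).Monic := Lagrange.nodal_monic
    rw [Monic, leadingCoeff, hN] at this
    exact this
  have hdeg : H.degree < (Finset.univ : Finset (Fin n)).card := by
    rw [Finset.card_univ, Fintype.card_fin, degree_lt_iff_coeff_zero]
    intro k hk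
    rcases (show n ≤ k from hk).eq_or_lt with rfl | hlt
    · rw [hH, coeff_sub, coeff_C_mul, hNc]; ring
    · rw [hH, coeff_sub, coeff_C_mul, coeff_eq_zero_of_natDegree_lt (by omega),
        coeff_eq_zero_of_natDegree_lt (p := Lagrange.nodal _ _) (by omega)]
      ring
  have hval : ∀ i, H.eval (v i) = G.eval (v i) := fun i => by
    simp [hH, Lagrange.eval_nodal_at_node (Finset.mem_univ i)]
  have key := congrArg (eval Y) (Lagrange.eq_interpolate (s := Finset.univ) hv.injOn hdeg)
  have hY : H.eval Y = G.eval Y - G.coeff n * ∏ j, (Y - v j) := by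
    simp [hH, Lagrange.eval_nodal]
  rw [← hY, key, Lagrange.interpolate_apply, eval_finsetSum]
  refine Finset.sum_congr rfl fun i _ => ?_
  rw [eval_mul, eval_C, hval, Lagrange.basis, eval_prod]
  congr 1
  refine Finset.prod_congr rfl fun j _ => ?_
  rw [Lagrange.basisDivisor, eval_mul, eval_C, eval_sub, eval_X, eval_C, div_eq_mul_inv, mul_comm]

/-- A single term of Koornwinder's operator applied to `∏ⱼ (Y + xⱼ + 1/xⱼ)`. -/
lemma koornwinder_term {n : ℕ} {a b c d q t α y Y : K} {x : Fin n → K} (i : Fin n)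
    (hx : ∀ j, x j ≠ 0) (hy : y ≠ 0) (hyi : y + y⁻¹ = x i + (x i)⁻¹)
    (hq : q ≠ 0) (ht : t ≠ 0) (hα : α ≠ 0) (ht1 : 1 - t ≠ 0)
    (h1 : 1 - y ^ 2 ≠ 0) (h2 : 1 - q * y ^ 2 ≠ 0) (h3 : 1 - t * y ^ 2 ≠ 0) :
    (1 - a * y) * (1 - b * y) * (1 - c * y) * (1 - d * y) /
        (α * t ^ (n - 1) * (1 - y ^ 2) * (1 - q * y ^ 2)) *
      (∏ j ∈ Finset.univ.erase i, ((1 - t * y * x j) * (1 - t * (y / x j))) /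
        ((1 - y * x j) * (1 - y / x j))) *
      ((q * y + (q * y)⁻¹ - (y + y⁻¹)) * ∏ j ∈ Finset.univ.erase i, (Y + (x j + (x j)⁻¹))) =
    -((1 - q) * t / (q * α * (1 - t))) *
      ((awWeight a b c d t y * ∏ j, (-(t * y + (t * y)⁻¹) + (x j + (x j)⁻¹))) *
        ∏ j ∈ Finset.univ.erase i,
          (Y - -(x j + (x j)⁻¹)) / (-(x i + (x i)⁻¹) - -(x j + (x j)⁻¹))) := by
  have hfac : ∀ j, ((1 - t * y * x j) * (1 - t * (y / x j))) / ((1 - y * x j) * (1 - y / x j)) =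
      t * ((-(t * y + (t * y)⁻¹) + (x j + (x j)⁻¹)) /
        (-(x i + (x i)⁻¹) - -(x j + (x j)⁻¹))) := by
    intro j
    have hj := hx j
    have e1 : (1 - t * y * x j) * (1 - t * (y / x j)) =
        -(t * y) * (-(t * y + (t * y)⁻¹) + (x j + (x j)⁻¹)) := by
      field_simp; ring
    have e2 : (1 - y * x j) * (1 - y / x j) =
        -y * (-(y + y⁻¹) - -(x j + (x j)⁻¹)) := by
      field_simp; ring
    rw [← hyi, e1, e2, mul_div_mul_comm]
    congr 1
    field_simp
  have hcard : (Finset.univ.erase i).card = n - 1 := by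
    rw [Finset.card_erase_of_mem (Finset.mem_univ i), Finset.card_univ, Fintype.card_fin]
  rw [Finset.prod_congr rfl fun j _ => hfac j, Finset.prod_mul_distrib, Finset.prod_const, hcard,
    ← Finset.mul_prod_erase _ (fun j => -(t * y + (t * y)⁻¹) + (x j + (x j)⁻¹)) (Finset.mem_univ i)]
  simp only [Finset.prod_div_distrib, sub_neg_eq_add, ← hyi]
  have e1 : q * y + (q * y)⁻¹ - (y + y⁻¹) = (1 - q) * (1 - q * y ^ 2) / (q * y) := by
    field_simp; ring
  -- The factor j = i supplies 1 - t y², cancelling that pole of `awWeight`, and `e1` cancels 1 - q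
  -- y². Thus q survives only in the constant in front.
  have e2 : -(t * y + (t * y)⁻¹) + (y + y⁻¹) = -((1 - t) * (1 - t * y ^ 2) / (t * y)) := by
    field_simp; ring
  have htn := pow_ne_zero (n - 1) ht
  rw [e1, e2, awWeight]
  generalize ∏ j ∈ Finset.univ.erase i, (-(t * y + (t * y)⁻¹) + (x j + (x j)⁻¹)) = P
  generalize ∏ j ∈ Finset.univ.erase i, (-(y + y⁻¹) + (x j + (x j)⁻¹)) = Q
  generalize ∏ j ∈ Finset.univ.erase i, (Y + (x j + (x j)⁻¹)) = R
  generalize t ^ (n - 1) = T at *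
  generalize 1 - t * y ^ 2 = D1 at *
  generalize 1 - q * y ^ 2 = D2 at *
  generalize 1 - y ^ 2 = D3 at *
  generalize 1 - t = D4 at *
  field_simp

/-- Vanishing at the infinitely many constants makes Σ r_k p_k the zero polynomial over K; leading
coefficients are then peeled off. This allows comparing coefficients of p_k(Y). -/
lemma eq_zero_of_forall_sum_eval_eq_zero [Algebra ℂ K] (p : ℕ → ℂ[X])
    (hp : ∀ i, (p i).Monic ∧ (p i).natDegree = i) (r : ℕ → K) (N : ℕ)
    (h : ∀ y : ℂ, ∑ k ∈ Finset.range N, algebraMap ℂ K ((p k).eval y) * r k = 0) :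
    ∀ k < N, r k = 0 := by
  have hQ : ∑ k ∈ Finset.range N, C (r k) * (p k).map (algebraMap ℂ K) = 0 := by
    refine eq_zero_of_infinite_isRoot _ (Set.Infinite.mono ?_
      (Set.infinite_range_of_injective (algebraMap ℂ K).injective))
    rintro _ ⟨y, rfl⟩
    rw [Set.mem_ofPred_eq, IsRoot, eval_finsetSum, ← h y]
    refine Finset.sum_congr rfl fun k _ => ?_
    rw [eval_mul, eval_C, eval_map_algebraMap, aeval_algebraMap_apply, coe_aeval_eq_eval, mul_comm]
  clear h
  induction N with
  | zero => intro k hk; omega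
  | succ N ih =>
    have hc : r N = 0 := by
      have := congrArg (fun Q => coeff Q N) hQ
      simp only [Finset.sum_range_succ, coeff_add, finsetSum_coeff, coeff_C_mul, coeff_map,
        coeff_zero] at this
      rw [Finset.sum_eq_zero, zero_add] at this
      · have hN := (hp N).1
        rw [Monic, leadingCoeff, (hp N).2] at hN
        simpa [hN] using this
      · intro k hk
        rw [coeff_eq_zero_of_natDegree_lt (by rw [(hp k).2]; exact Finset.mem_range.1 hk)]
        simp
    rw [Finset.sum_range_succ, hc] at hQ
    simp only [map_zero, zero_mul, add_zero] at hQ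
    intro k hk
    rcases (Nat.lt_succ_iff.1 hk).eq_or_lt with rfl | hk
    · exact hc
    · exact ih hQ k hk

end Field

end Koornwinder
end

noncomputable section
namespace Koornwinder

/-! ### Column orbit sums -/

/-- The exponents with entries in `{-1, 0, 1}`. -/
def smallExponents (n : ℕ) : Finset (Fin n → ℤ) :=
  Fintype.piFinset fun _ => ({-1, 0, 1} : Finset ℤ)

lemma card_filter_val_lt {n r : ℕ} (hr : r ≤ n) :
    (Finset.univ.filter fun i : Fin n => (i : ℕ) < r).card = r := by
  rw [Fin.card_filter_val_lt, min_eq_right hr]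

lemma orbit_column {n r : ℕ} (hr : r ≤ n) :
    orbit (fun i => ((column n r i : ℕ) : ℤ)) = (smallExponents n).filter
      fun ν => (Finset.univ.filter fun i => ν i ≠ 0).card = r := by
  ext ν
  simp only [orbit, smallExponents, Finset.mem_image, Finset.mem_univ, true_and,
    Finset.mem_filter, Fintype.mem_piFinset, Finset.mem_insert, Finset.mem_singleton]
  constructor
  · rintro ⟨⟨σ, ε⟩, rfl⟩
    refine ⟨fun i => ?_, ?_⟩
    · rcases Int.units_eq_one_or (ε i) with h | h <;> simp only [h, column] <;> split_ifs <;> simp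
    · have : (Finset.univ.filter fun i => ((ε i : ℤ) * ((column n r (σ i) : ℕ) : ℤ)) ≠ 0) =
          (Finset.univ.filter fun i : Fin n => (i : ℕ) < r).map σ.symm.toEmbedding := by
        ext i
        simp [column, Finset.mem_map_equiv]
      rw [this, Finset.card_map, card_filter_val_lt hr]
  · rintro ⟨hν, hcard⟩
    -- A bijection of the support of ν with the first r indices extends to the required permutation;
    -- the signs are those of ν.
    have e : {i // ν i ≠ 0} ≃ {i : Fin n // (i : ℕ) < r} := Fintype.equivOfCardEq (by
      rw [Fintype.card_subtype, Fintype.card_subtype, hcard, card_filter_val_lt hr])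
    refine ⟨⟨e.extendSubtype, fun i => if ν i = -1 then -1 else 1⟩, ?_⟩
    ext i
    by_cases h0 : ν i = 0
    · have := e.extendSubtype_not_mem i (by simpa using h0)
      simp [column, this, h0]
    · have := e.extendSubtype_mem i h0
      rcases hν i with h | h | h
      · simp [column, this, h]
      · exact absurd h h0
      · simp [column, this, h]

lemma m_column {n r : ℕ} (hr : r ≤ n) :
    m (column n r) = ∑ ν ∈ (smallExponents n).filter
      (fun ν => (Finset.univ.filter fun i => ν i ≠ 0).card = r),
        (AddMonoidAlgebra.single ν 1 : Laurent n) := by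
  rw [m, orbit_column hr]

lemma m_column_zero (n : ℕ) : m (column n 0) = 1 := by
  have : orbit (fun i => ((column n 0 i : ℕ) : ℤ)) = {0} := by
    ext ν
    simp only [orbit, column, Finset.mem_image, Finset.mem_univ, true_and, Finset.mem_singleton]
    simp [funext_iff, eq_comm]
  rw [m, this, Finset.sum_singleton]
  rfl

lemma sum_column {n s : ℕ} (hs : s ≤ n) : ∑ i, column n s i = s := by
  simp only [column]
  rw [Finset.sum_boole, card_filter_val_lt hs, Nat.cast_id]

lemma coeff_m_column {n r s : ℕ} (hr : r ≤ n) (hs : s ≤ n) :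
    (m (column n r)).coeff (fun i => ((column n s i : ℕ) : ℤ)) = if r = s then 1 else 0 := by
  have hmem : (fun i => ((column n s i : ℕ) : ℤ)) ∈ (smallExponents n).filter
      (fun ν => (Finset.univ.filter fun i => ν i ≠ 0).card = r) ↔ r = s := by
    have h : (Finset.univ.filter fun i : Fin n => ((column n s i : ℕ) : ℤ) ≠ 0) =
        Finset.univ.filter fun i : Fin n => (i : ℕ) < s := by
      ext i; simp [column]
    rw [Finset.mem_filter, h, card_filter_val_lt hs]
    refine ⟨fun h => h.2.symm, fun h => ⟨?_, h.symm⟩⟩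
    rw [smallExponents, Fintype.mem_piFinset]
    intro i
    simp only [column]
    split_ifs <;> simp
  rw [m_column hr, AddMonoidAlgebra.coeff_sum, Finsupp.finsetSum_apply]
  simp only [AddMonoidAlgebra.coeff_single, Finsupp.single_apply]
  rw [Finset.sum_ite_eq']
  simp only [hmem]

/-- The generating function `∏ᵢ (Y + xᵢ + 1/xᵢ)`. -/
def genFun (n : ℕ) (Y : ℂ) : Laurent n :=
  ∏ i, (algebraMap ℂ (Laurent n) Y + AddMonoidAlgebra.single (Pi.single i 1) 1 +
    AddMonoidAlgebra.single (Pi.single i (-1)) 1)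

lemma prod_single {n : ℕ} (ν : Fin n → ℤ) (r : Fin n → ℂ) :
    ∏ i, (AddMonoidAlgebra.single (Pi.single i (ν i)) (r i) : Laurent n) =
      AddMonoidAlgebra.single ν (∏ i, r i) := by
  have : ∀ s : Finset (Fin n), ∏ i ∈ s, (AddMonoidAlgebra.single (Pi.single i (ν i)) (r i) :
      Laurent n) = AddMonoidAlgebra.single (∑ i ∈ s, Pi.single i (ν i)) (∏ i ∈ s, r i) := by
    intro s
    induction s using Finset.cons_induction with
    | empty => rfl
    | cons i s hi ih =>
      rw [Finset.prod_cons, ih, AddMonoidAlgebra.single_mul_single, Finset.sum_cons,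
        Finset.prod_cons]
  rw [this, Finset.univ_sum_single]

/-- Expanding the product chooses an exponent in {-1, 0, 1} for every variable, with a factor Y for
each 0; the terms are grouped by the number of zeros. -/
lemma genFun_eq_sum (n : ℕ) (Y : ℂ) :
    genFun n Y = ∑ j ∈ Finset.range (n + 1), Y ^ j • m (column n (n - j)) := by
  have h1 : genFun n Y = ∑ ν ∈ smallExponents n,
      Y ^ (Finset.univ.filter fun i => ν i = 0).card •
        (AddMonoidAlgebra.single ν 1 : Laurent n) := by
    have hfac : ∀ i : Fin n, algebraMap ℂ (Laurent n) Y + AddMonoidAlgebra.single (Pi.single i 1) 1 +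
        AddMonoidAlgebra.single (Pi.single i (-1)) 1 = ∑ e ∈ ({-1, 0, 1} : Finset ℤ),
          AddMonoidAlgebra.single (Pi.single i e) (if e = 0 then Y else 1) := by
      intro i
      rw [Finset.sum_insert (by decide), Finset.sum_insert (by decide), Finset.sum_singleton]
      have : algebraMap ℂ (Laurent n) Y = AddMonoidAlgebra.single 0 Y := rfl
      rw [this]
      simp
      ring
    rw [genFun, Finset.prod_congr rfl fun i _ => hfac i, Finset.prod_univ_sum]
    refine Finset.sum_congr rfl fun ν _ => ?_
    rw [prod_single, AddMonoidAlgebra.smul_single, smul_eq_mul, mul_one, Finset.prod_ite,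
      Finset.prod_const, Finset.prod_const_one, mul_one]
  have hcard : ∀ ν : Fin n → ℤ, (Finset.univ.filter fun i => ν i = 0).card +
      (Finset.univ.filter fun i => ν i ≠ 0).card = n := by
    intro ν
    rw [Finset.card_filter_add_card_filter_not, Finset.card_univ, Fintype.card_fin]
  rw [h1, ← Finset.sum_fiberwise_of_maps_to (t := Finset.range (n + 1))
    (g := fun ν => (Finset.univ.filter fun i => ν i = 0).card)]
  · refine Finset.sum_congr rfl fun j hj => ?_
    rw [m_column (Nat.sub_le n j), Finset.smul_sum]
    have hj := Finset.mem_range.1 hj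
    refine Finset.sum_congr ?_ ?_
    · ext ν
      have := hcard ν
      simp only [Finset.mem_filter, and_congr_right_iff]
      intro _
      omega
    · intro ν hν
      have := hcard ν
      have h2 := (Finset.mem_filter.1 hν).2
      rw [show (Finset.univ.filter fun i => ν i = 0).card = j by omega]
  · intro ν _
    have := hcard ν
    simp only [Finset.mem_range]
    omega

/-! ### The operator as a linear map -/

lemma shift_add {n : ℕ} (u : ℂ) (i : Fin n) (P Q : Laurent n) :
    shift u i (P + Q) = shift u i P + shift u i Q := by
  have h : ∀ P : Laurent n, shift u i P =
      P.coeff.sum fun μ r => AddMonoidAlgebra.single μ (u ^ μ i * r) := fun P => rfl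
  rw [h, h, h, AddMonoidAlgebra.coeff_add, Finsupp.sum_add_index']
  · simp
  · intro μ r s; rw [mul_add, AddMonoidAlgebra.single_add]

lemma shift_single {n : ℕ} (u : ℂ) (i : Fin n) (μ : Fin n → ℤ) (r : ℂ) :
    shift u i (AddMonoidAlgebra.single μ r) = AddMonoidAlgebra.single μ (u ^ μ i * r) := by
  have h : ∀ P : Laurent n, shift u i P =
      P.coeff.sum fun μ r => AddMonoidAlgebra.single μ (u ^ μ i * r) := fun P => rfl
  rw [h, AddMonoidAlgebra.coeff_single, Finsupp.sum_single_index]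
  simp

/-- The shift as a homomorphism of algebras. -/
def shiftHom {n : ℕ} (u : ℂ) (hu : u ≠ 0) (i : Fin n) : Laurent n →ₐ[ℂ] Laurent n :=
  AddMonoidAlgebra.lift ℂ (Laurent n) (Fin n → ℤ)
    { toFun := fun μ => AddMonoidAlgebra.single μ.toAdd (u ^ μ.toAdd i)
      map_one' := by simp; rfl
      map_mul' := fun μ ν => by
        rw [AddMonoidAlgebra.single_mul_single, toAdd_mul, Pi.add_apply, zpow_add₀ hu] }

lemma shiftHom_apply {n : ℕ} (u : ℂ) (hu : u ≠ 0) (i : Fin n) (P : Laurent n) :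
    shiftHom u hu i P = shift u i P := by
  induction P using AddMonoidAlgebra.induction_linear with
  | zero => rw [map_zero]; rfl
  | add P Q hP hQ => rw [map_add, shift_add, hP, hQ]
  | single μ r =>
    rw [shift_single, shiftHom, AddMonoidAlgebra.lift_single]
    simp [mul_comm]

lemma genFun_eq_mul {n : ℕ} (i : Fin n) (Y : ℂ) :
    genFun n Y = (algebraMap ℂ (Laurent n) Y + AddMonoidAlgebra.single (Pi.single i 1) 1 +
        AddMonoidAlgebra.single (Pi.single i (-1)) 1) *
      ∏ j ∈ Finset.univ.erase i, (algebraMap ℂ (Laurent n) Y +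
        AddMonoidAlgebra.single (Pi.single j 1) 1 + AddMonoidAlgebra.single (Pi.single j (-1)) 1) :=
  (Finset.mul_prod_erase _ _ (Finset.mem_univ i)).symm

lemma shift_genFun {n : ℕ} (u : ℂ) (hu : u ≠ 0) (i : Fin n) (Y : ℂ) :
    shift u i (genFun n Y) - genFun n Y =
      (algebraMap ℂ _ u * AddMonoidAlgebra.single (Pi.single i 1) 1 +
        algebraMap ℂ _ u⁻¹ * AddMonoidAlgebra.single (Pi.single i (-1)) 1 -
        (AddMonoidAlgebra.single (Pi.single i 1) 1 +
          AddMonoidAlgebra.single (Pi.single i (-1)) 1)) *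
      ∏ j ∈ Finset.univ.erase i, (algebraMap ℂ (Laurent n) Y +
        (AddMonoidAlgebra.single (Pi.single j 1) 1 +
          AddMonoidAlgebra.single (Pi.single j (-1)) 1)) := by
  have hs : ∀ (j : Fin n) (e : ℤ), shiftHom u hu i (AddMonoidAlgebra.single (Pi.single j e) 1) =
      AddMonoidAlgebra.single (Pi.single j e) (if j = i then u ^ e else 1) := by
    intro j e
    rw [shiftHom_apply, shift_single]
    by_cases h : j = i
    · subst h; simp
    · simp [h]
  have hu' : ∀ (v : ℂ) (e : ℤ), (AddMonoidAlgebra.single (Pi.single i e) v : Laurent n) =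
      algebraMap ℂ _ v * AddMonoidAlgebra.single (Pi.single i e) 1 := by
    intro v e
    rw [← Algebra.smul_def, AddMonoidAlgebra.smul_single, smul_eq_mul, mul_one]
  rw [← shiftHom_apply u hu, genFun_eq_mul i, map_mul, map_prod]
  simp only [map_add, AlgHom.commutes, hs, if_true]
  have hprod : ∏ j ∈ Finset.univ.erase i, (algebraMap ℂ (Laurent n) Y +
      AddMonoidAlgebra.single (Pi.single j 1) (if j = i then u ^ (1 : ℤ) else 1) +
      AddMonoidAlgebra.single (Pi.single j (-1)) (if j = i then u ^ (-1 : ℤ) else 1)) =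
      ∏ j ∈ Finset.univ.erase i, (algebraMap ℂ (Laurent n) Y +
        (AddMonoidAlgebra.single (Pi.single j 1) 1 +
          AddMonoidAlgebra.single (Pi.single j (-1)) 1)) := by
    refine Finset.prod_congr rfl fun j hj => ?_
    rw [if_neg (Finset.ne_of_mem_erase hj), if_neg (Finset.ne_of_mem_erase hj), add_assoc]
  rw [hprod, hu' (u ^ (1 : ℤ)), hu' (u ^ (-1 : ℤ)), zpow_one, zpow_neg_one]
  simp only [add_assoc]
  ring

lemma const_mul_toRat {n : ℕ} (z : ℂ) (P : Laurent n) : const n z * toRat P = toRat (z • P) := by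
  rw [const, toRat, toRat, Algebra.smul_def, map_mul, ← IsScalarTower.algebraMap_apply]

lemma toRat_injective {n : ℕ} : Function.Injective (toRat (n := n)) :=
  IsFractionRing.injective (Laurent n) (RatFun n)

/-- Koornwinder's operator as a linear map. -/
def opLinear (a b c d q t α : ℂ) (hq : q ≠ 0) (n : ℕ) : Laurent n →ₗ[ℂ] RatFun n where
  toFun P := op a b c d q t α P
  map_add' P Q := by
    simp only [op, shift_add, add_sub_add_comm, toRat, map_add, mul_add, Finset.sum_add_distrib]
    ring
  map_smul' z P := by
    have h : ∀ (u : ℂ) (hu : u ≠ 0) (i : Fin n), toRat (shift u i (z • P) - z • P) =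
        const n z * toRat (shift u i P - P) := by
      intro u hu i
      rw [const_mul_toRat, ← shiftHom_apply u hu, map_smul, smul_sub, shiftHom_apply]
    change op a b c d q t α (z • P) = z • op a b c d q t α P
    rw [Algebra.smul_def z (op a b c d q t α P)]
    change _ = const n z * _
    simp only [op, h q hq, h q⁻¹ (inv_ne_zero hq), mul_add, Finset.mul_sum,
      mul_left_comm (const n z)]

lemma opLinear_apply (a b c d q t α : ℂ) (hq : q ≠ 0) {n : ℕ} (P : Laurent n) :
    opLinear a b c d q t α hq n P = op a b c d q t α P := rfl

end Koornwinder
end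

noncomputable section
namespace Koornwinder
open Polynomial

/-! ### Eigenvectors of Koornwinder's operator -/

variable {a b c d t : ℂ}

/-- The vector `C m⁽ⁿ⁾`. -/
def columnVector (M : Matrix ℕ ℕ ℂ) (n k : ℕ) : Laurent n :=
  ∑ j ∈ Finset.range (n + 1), M k j • m (column n (n - j))

lemma genFun_eq_sum_columnVector {M : Matrix ℕ ℕ ℂ} (hM : IsTransitionMatrix a b c d t M) (n : ℕ)
    (Y : ℂ) : genFun n Y =
      ∑ k ∈ Finset.range (n + 1), (recPoly a b c d t k).eval Y • columnVector M n k := by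
  have h : ∀ j ∈ Finset.range (n + 1), Y ^ j • m (column n (n - j)) =
      ∑ k ∈ Finset.range (n + 1),
        ((recPoly a b c d t k).eval Y * M k j) • m (column n (n - j)) := by
    intro j hj
    have := congrArg (eval Y) (hM.X_pow_eq_sum j (n + 1) (Finset.mem_range.1 hj))
    rw [eval_pow, eval_X, eval_finsetSum] at this
    rw [this, Finset.sum_smul]
    simp only [eval_mul, eval_C, mul_comm]
  rw [genFun_eq_sum, Finset.sum_congr rfl h, Finset.sum_comm]
  simp only [columnVector, Finset.smul_sum, mul_smul]

lemma columnVector_self {M : Matrix ℕ ℕ ℂ} (hM : IsTransitionMatrix a b c d t M) (n : ℕ) :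
    columnVector M n n = 1 := by
  rw [columnVector, Finset.sum_range_succ, Finset.sum_eq_zero]
  · simp [hM.diag, m_column_zero]
  · intro j hj
    rw [hM.upper n j (Finset.mem_range.1 hj), zero_smul]

section RatFun

variable {n : ℕ}

lemma toRat_single_mul (i : Fin n) (e e' : ℤ) :
    toRat (AddMonoidAlgebra.single (Pi.single i e) (1 : ℂ)) *
      toRat (AddMonoidAlgebra.single (Pi.single i e') 1) =
      toRat (AddMonoidAlgebra.single (Pi.single i (e + e')) 1) := by
  rw [toRat, toRat, ← map_mul, AddMonoidAlgebra.single_mul_single, ← Pi.single_add, mul_one, toRat]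

lemma toRat_single_zero (i : Fin n) :
    toRat (AddMonoidAlgebra.single (Pi.single i 0) (1 : ℂ)) = 1 := by
  rw [Pi.single_zero]; exact map_one _

lemma x_ne_zero (i : Fin n) : x i ≠ 0 := by
  intro h
  have := toRat_single_mul i 1 (-1)
  rw [add_neg_cancel, toRat_single_zero] at this
  rw [x] at h
  simp [h] at this

lemma x_inv (i : Fin n) : (x i)⁻¹ = toRat (AddMonoidAlgebra.single (Pi.single i (-1)) 1) := by
  have := toRat_single_mul i 1 (-1)
  rw [add_neg_cancel, toRat_single_zero] at this
  exact inv_eq_of_mul_eq_one_right this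

lemma one_sub_const_mul_ne_zero (i : Fin n) (z : ℂ) {e : ℤ} (he : e ≠ 0) :
    1 - const n z * toRat (AddMonoidAlgebra.single (Pi.single i e) 1) ≠ 0 := by
  intro h
  have h1 : toRat (1 : Laurent n) = toRat (z • AddMonoidAlgebra.single (Pi.single i e) 1) := by
    rw [← const_mul_toRat, ← sub_eq_zero, ← h]
    congr 1
    exact map_one _
  have h2 := congrArg (fun P : Laurent n => P.coeff 0) (toRat_injective h1)
  have h3 : (Pi.single i e : Fin n → ℤ) ≠ 0 := by simpa using he
  have h4 : (1 : Laurent n).coeff 0 = 1 := by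
    change (AddMonoidAlgebra.single (0 : Fin n → ℤ) (1 : ℂ)).coeff 0 = 1
    simp
  simp [h4, h3] at h2

lemma one_sub_const_mul_x_sq_ne_zero (i : Fin n) (z : ℂ) : 1 - const n z * x i ^ 2 ≠ 0 := by
  rw [sq, x, toRat_single_mul]
  exact one_sub_const_mul_ne_zero i z (by norm_num)

lemma one_sub_const_mul_x_inv_sq_ne_zero (i : Fin n) (z : ℂ) :
    1 - const n z * (x i)⁻¹ ^ 2 ≠ 0 := by
  rw [sq, x_inv, toRat_single_mul]
  exact one_sub_const_mul_ne_zero i z (by norm_num)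

/-- These are the interpolation nodes for `op_genFun`. -/
lemma neg_x_add_inv_injective : Function.Injective fun i : Fin n => -(x i + (x i)⁻¹) := by
  intro i j hij
  have h1 : x i + (x i)⁻¹ = x j + (x j)⁻¹ := neg_injective hij
  rw [x_inv, x_inv, x, x, toRat, toRat, toRat, toRat, ← map_add, ← map_add] at h1
  have h2 := congrArg (fun P : Laurent n => P.coeff (Pi.single i 1)) (toRat_injective h1)
  by_contra hne
  have h3 : (Pi.single i (-1) : Fin n → ℤ) ≠ Pi.single i 1 := fun h => by
    have := congrFun h i
    simp at this
  have h4 : ∀ e, (Pi.single j e : Fin n → ℤ) ≠ Pi.single i 1 := fun e h => by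
    have := congrFun h i
    simp [Pi.single_eq_of_ne hne] at this
  simp [h4] at h2

lemma const_ne_zero {z : ℂ} (hz : z ≠ 0) : const n z ≠ 0 := (_root_.map_ne_zero _).2 hz

lemma toRat_algebraMap (z : ℂ) : toRat (algebraMap ℂ (Laurent n) z) = const n z :=
  (IsScalarTower.algebraMap_apply ℂ (Laurent n) (RatFun n) z).symm

lemma toRat_shift_genFun (u : ℂ) (hu : u ≠ 0) (i : Fin n) (Y : ℂ) :
    toRat (shift u i (genFun n Y) - genFun n Y) =
      (const n u * x i + (const n u)⁻¹ * (x i)⁻¹ - (x i + (x i)⁻¹)) *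
        ∏ j ∈ Finset.univ.erase i, (const n Y + (x j + (x j)⁻¹)) := by
  have hinv : (const n u)⁻¹ = toRat (algebraMap ℂ (Laurent n) u⁻¹) := by
    rw [toRat_algebraMap, const, const, map_inv₀]
  rw [shift_genFun u hu, hinv]
  simp only [x_inv]
  simp only [x, ← toRat_algebraMap]
  simp only [toRat, map_mul, map_sub, map_add, map_prod]

lemma toRat_genFun (Y : ℂ) : toRat (genFun n Y) = ∏ j, (const n Y + (x j + (x j)⁻¹)) := by
  simp only [x_inv]
  simp only [x, ← toRat_algebraMap]
  simp only [genFun, toRat, map_add, map_prod, add_assoc]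

/-- The expansion of the generating function, as an identity of polynomials in `Y`. -/
lemma prod_X_add_eq_sum {M : Matrix ℕ ℕ ℂ} (hM : IsTransitionMatrix a b c d t M) :
    ∏ j : Fin n, (X + C (x j + (x j)⁻¹)) = ∑ k ∈ Finset.range (n + 1),
      C (toRat (columnVector M n k)) * (recPoly a b c d t k).map (algebraMap ℂ (RatFun n)) := by
  -- The expansion is known for constant Y only; as a polynomial identity it may also be evaluated
  -- at the nodes and their t-shifts.
  refine eq_of_infinite_eval_eq _ _ (Set.Infinite.mono ?_
    (Set.infinite_range_of_injective (algebraMap ℂ (RatFun n)).injective))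
  rintro _ ⟨y, rfl⟩
  rw [Set.mem_ofPred_eq, eval_prod, eval_finsetSum]
  have h := toRat_genFun (n := n) y
  simp only [eval_add, eval_X, eval_C]
  rw [show algebraMap ℂ (RatFun n) y = const n y from rfl, ← h, genFun_eq_sum_columnVector hM,
    toRat, map_sum]
  refine Finset.sum_congr rfl fun k _ => ?_
  rw [eval_mul, eval_C, const, eval_map_algebraMap, aeval_algebraMap_apply, coe_aeval_eq_eval,
    mul_comm]
  exact (const_mul_toRat _ _).symm

/-- The polynomial interpolating the Askey–Wilson operator applied to the generating function. -/
def interpolant (a b c d t : ℂ) (M : Matrix ℕ ℕ ℂ) (n : ℕ) : (RatFun n)[X] :=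
  ∑ k ∈ Finset.range (n + 1),
    C (const n (awEigenvalue (a * b * c * d) t k) * toRat (columnVector M n k)) *
      (recPoly a b c d t k).map (algebraMap ℂ (RatFun n))

/-- Only k = n contributes in degree n, and the last vector is m_∅ = 1. This top coefficient is the
correction term of the interpolation. -/
lemma interpolant_natDegree_coeff {M : Matrix ℕ ℕ ℂ} (hM : IsTransitionMatrix a b c d t M) :
    (interpolant a b c d t M n).natDegree ≤ n ∧
      (interpolant a b c d t M n).coeff n = const n (awEigenvalue (a * b * c * d) t n) := by
  have hp := threeTerm_monic_natDegree (fun i => g a b c d t (t ^ i)) (fun i => f a b c d t (t ^ i))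
  constructor
  · refine natDegree_sum_le_of_forall_le _ _ fun k hk => ?_
    refine (natDegree_C_mul_le _ _).trans (natDegree_map_le.trans ?_)
    rw [(hp k).2]
    exact Nat.lt_succ_iff.1 (Finset.mem_range.1 hk)
  · rw [interpolant, finsetSum_coeff, Finset.sum_range_succ, Finset.sum_eq_zero]
    · have hN := (hp n).1
      rw [Monic, leadingCoeff, (hp n).2] at hN
      rw [coeff_C_mul, coeff_map, hN, columnVector_self hM, toRat, map_one, map_one]
      ring
    · intro k hk
      rw [coeff_C_mul, coeff_map, coeff_eq_zero_of_natDegree_lt, map_zero, mul_zero]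
      rw [(hp k).2]
      exact Finset.mem_range.1 hk

/-- The interpolant is the Askey–Wilson operator applied to the kernel in Y; at a node the kernel
vanishes (`h0`) and only the two shifted terms remain. -/
lemma eval_interpolant (h : GenericParams a b c d t) {M : Matrix ℕ ℕ ℂ}
    (hM : IsTransitionMatrix a b c d t M) (i : Fin n) :
    (interpolant a b c d t M n).eval (-(x i + (x i)⁻¹)) =
      awWeight (const n a) (const n b) (const n c) (const n d) (const n t) (x i) *
        ∏ j, (-(const n t * x i + (const n t * x i)⁻¹) + (x j + (x j)⁻¹)) +
      awWeight (const n a) (const n b) (const n c) (const n d) (const n t) (x i)⁻¹ *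
        ∏ j, (-(const n t * (x i)⁻¹ + (const n t * (x i)⁻¹)⁻¹) + (x j + (x j)⁻¹)) := by
  have hF : ∀ Z : RatFun n, ∏ j, (Z + (x j + (x j)⁻¹)) = ∑ k ∈ Finset.range (n + 1),
      toRat (columnVector M n k) * aeval Z (recPoly a b c d t k) := by
    intro Z
    have := congrArg (eval Z) (prod_X_add_eq_sum (n := n) hM)
    simpa only [eval_prod, eval_finsetSum, eval_add, eval_X, eval_C, eval_mul,
      eval_map_algebraMap] using this
  have h0 : ∏ j, (-(x i + (x i)⁻¹) + (x j + (x j)⁻¹)) = 0 :=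
    Finset.prod_eq_zero (Finset.mem_univ i) (neg_add_cancel _)
  have h1 : x i ^ 2 ≠ 1 := by
    have := one_sub_const_mul_x_sq_ne_zero i 1
    rw [const, map_one, one_mul] at this
    exact fun h => this (by rw [h, sub_self])
  have h2 : algebraMap ℂ (RatFun n) t * x i ^ 2 ≠ 1 :=
    (sub_ne_zero.1 (one_sub_const_mul_x_sq_ne_zero i t)).symm
  have h3 : x i ^ 2 ≠ algebraMap ℂ (RatFun n) t := by
    intro h3
    apply one_sub_const_mul_x_inv_sq_ne_zero i t
    rw [const, ← h3]
    have := x_ne_zero i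
    field_simp
    ring
  have key := awOp_sum (const n a) (const n b) (const n c) (const n d) (const n t)
    (Finset.range (n + 1)) (fun k => toRat (columnVector M n k))
    (fun k Z => aeval Z (recPoly a b c d t k)) (x i)
  simp only [← hF, const, awOp_recPoly h (x_ne_zero i) h1 h2 h3] at key
  rw [awOp, h0, sub_zero, sub_zero] at key
  rw [const, const, const, const, const, key, interpolant, eval_finsetSum]
  refine Finset.sum_congr rfl fun k _ => ?_
  rw [eval_mul, eval_C, eval_map_algebraMap, const]
  ring

/-- Koornwinder's operator on the generating function. -/
lemma op_genFun (h : GenericParams a b c d t) {M : Matrix ℕ ℕ ℂ}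
    (hM : IsTransitionMatrix a b c d t M) {q α : ℂ} (hq : q ≠ 0) (hα : α ≠ 0) (Y : ℂ) :
    op a b c d q t α (genFun n Y) = const n (-((1 - q) * t / (q * α * (1 - t)))) *
      ((interpolant a b c d t M n).eval (const n Y) -
        const n (awEigenvalue (a * b * c * d) t n) * toRat (genFun n Y)) := by
  have ht1 : 1 - t ≠ 0 := by simpa using h.one_sub_pow_ne 0
  have hc1 : ∀ z : ℂ, const n (1 - z) = 1 - const n z := fun z => by
    rw [const, map_sub, map_one]; rfl
  have hone : const n 1 = 1 := map_one _
  have hx1 : ∀ i : Fin n, 1 - x i ^ 2 ≠ 0 := fun i => by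
    simpa [hone] using one_sub_const_mul_x_sq_ne_zero i 1
  have hx2 : ∀ i : Fin n, 1 - (x i)⁻¹ ^ 2 ≠ 0 := fun i => by
    simpa only [hone, one_mul] using one_sub_const_mul_x_inv_sq_ne_zero i 1
  have hT : (1 : RatFun n) - const n t ≠ 0 := by rw [← hc1]; exact const_ne_zero ht1
  obtain ⟨hdeg, hcoeff⟩ := interpolant_natDegree_coeff (n := n) hM
  have hK : const n (-((1 - q) * t / (q * α * (1 - t)))) =
      -((1 - const n q) * const n t / (const n q * const n α * (1 - const n t))) := by
    simp only [const, map_neg, map_div₀, map_mul, map_sub, map_one]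
  have hinv : const n q⁻¹ = (const n q)⁻¹ := map_inv₀ _ _
  have lag := sum_eval_mul_prod_div _ hdeg (neg_x_add_inv_injective (n := n)) (const n Y)
  rw [hcoeff] at lag
  have hprod : ∏ j : Fin n, (const n Y - -(x j + (x j)⁻¹)) = toRat (genFun n Y) := by
    rw [toRat_genFun]
    simp only [sub_neg_eq_add]
  rw [hprod] at lag
  rw [hK, ← lag, Finset.mul_sum, op, ← Finset.sum_add_distrib]
  refine Finset.sum_congr rfl fun i _ => ?_
  have t1 := koornwinder_term (a := const n a) (b := const n b) (c := const n c) (d := const n d)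
    (q := const n q) (t := const n t) (α := const n α) (y := x i) (Y := const n Y) (x := x) i
    x_ne_zero (x_ne_zero i) rfl (const_ne_zero hq) (const_ne_zero h.t_ne) (const_ne_zero hα) hT
    (hx1 i) (one_sub_const_mul_x_sq_ne_zero i q) (one_sub_const_mul_x_sq_ne_zero i t)
  -- Shifting xᵢ by 1/q is shifting 1/xᵢ by q, so the same identity serves with y = 1/xᵢ.
  have t2 := koornwinder_term (a := const n a) (b := const n b) (c := const n c) (d := const n d)
    (q := const n q) (t := const n t) (α := const n α) (y := (x i)⁻¹) (Y := const n Y) (x := x) i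
    x_ne_zero (inv_ne_zero (x_ne_zero i)) (by rw [inv_inv, add_comm]) (const_ne_zero hq)
    (const_ne_zero h.t_ne) (const_ne_zero hα) hT
    (hx2 i) (one_sub_const_mul_x_inv_sq_ne_zero i q) (one_sub_const_mul_x_inv_sq_ne_zero i t)
  rw [eval_interpolant h hM, toRat_shift_genFun q hq, toRat_shift_genFun q⁻¹ (inv_ne_zero hq),
    opCoeff, opCoeff, one_div, hinv, inv_inv, ← mul_inv, add_mul, mul_add, ← t1, ← t2]
  congr 2
  rw [mul_inv (const n q), inv_inv]
  ring

end RatFun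

end Koornwinder
end

/-! ### Eigenvalues and the eigenvalue equation for the columns -/

noncomputable section
namespace Koornwinder
open Polynomial

variable {a b c d t : ℂ}

lemma awEigenvalue_sub (h : GenericParams a b c d t) (k l : ℕ) :
    awEigenvalue (a * b * c * d) t (k + l + 1) - awEigenvalue (a * b * c * d) t k =
      (t ^ k - t ^ (k + l + 1)) * (t - a * b * c * d * t ^ (k + l + 1 + k)) /
        (t ^ (k + l + 1) * t ^ k * t) := by
  have h1 := h.pow_ne k
  have h2 := h.pow_ne (k + l + 1)
  have ht := h.t_ne
  rw [awEigenvalue, awEigenvalue, pow_add t _ k]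
  generalize t ^ k = u at *
  generalize t ^ (k + l + 1) = s at *
  field_simp
  ring

lemma awEigenvalue_sub_ne_zero (h : GenericParams a b c d t) (k l : ℕ) :
    awEigenvalue (a * b * c * d) t (k + l + 1) - awEigenvalue (a * b * c * d) t k ≠ 0 := by
  rw [awEigenvalue_sub h]
  exact div_ne_zero (mul_ne_zero (h.pow_sub_pow_ne k l) (h.sub_ne _))
    (mul_ne_zero (mul_ne_zero (h.pow_ne _) (h.pow_ne _)) h.t_ne)

/-- The sum telescopes: by α² q = abcd, each bracket is a constant times a difference of consecutive
Askey–Wilson eigenvalues. -/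
lemma eigenvalue_column (h : GenericParams a b c d t) {q α : ℂ} (hq : q ≠ 0) (hα : α ≠ 0)
    (hαq : α ^ 2 = a * b * c * d / q) (n r : ℕ) (hr : r ≤ n) :
    eigenvalue q t α (column n r) = -((1 - q) * t / (q * α * (1 - t))) *
      (awEigenvalue (a * b * c * d) t (n - r) - awEigenvalue (a * b * c * d) t n) := by
  have ht := h.t_ne
  have ht1 : 1 - t ≠ 0 := by simpa using h.one_sub_pow_ne 0
  have hA : a * b * c * d = α ^ 2 * q := by rw [hαq]; field_simp
  have hsum : eigenvalue q t α (column n r) =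
      ∑ j ∈ Finset.range r, bracket (α * t ^ (n - 1 - j) * q) (α * t ^ (n - 1 - j)) := by
    have h1 : ∀ j : Fin n, bracket (α * t ^ (n - 1 - (j : ℕ)) * q ^ column n r j)
        (α * t ^ (n - 1 - (j : ℕ))) = (fun j : ℕ => if j < r then
          bracket (α * t ^ (n - 1 - j) * q) (α * t ^ (n - 1 - j)) else 0) (j : ℕ) := by
      intro j
      by_cases hj : (j : ℕ) < r
      · simp [column, hj]
      · simp [column, hj, bracket]
    rw [eigenvalue, Finset.sum_congr rfl fun j _ => h1 j,
      Fin.sum_univ_eq_sum_range (fun j : ℕ => if j < r then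
        bracket (α * t ^ (n - 1 - j) * q) (α * t ^ (n - 1 - j)) else 0) n,
      ← Finset.sum_filter]
    refine Finset.sum_congr ?_ fun _ _ => rfl
    ext j
    simp only [Finset.mem_filter, Finset.mem_range]
    omega
  rw [hsum]
  clear hsum
  induction r with
  | zero => simp
  | succ r ih =>
    obtain ⟨p, rfl⟩ : ∃ p, n = p + r + 1 := ⟨n - r - 1, by omega⟩
    rw [Finset.sum_range_succ, ih (by omega), show p + r + 1 - r = p + 1 by omega,
      show p + r + 1 - (r + 1) = p by omega, show p + r + 1 - 1 - r = p by omega]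
    have key := awEigenvalue_sub h p 0
    have hp := h.pow_ne p
    have e1 : t ^ (p + 0 + 1) = t ^ p * t := by ring
    have e2 : t ^ (p + 0 + 1 + p) = t ^ p * t ^ p * t := by ring
    rw [e1, e2, add_zero] at key
    have key2 : bracket (α * t ^ p * q) (α * t ^ p) = -((1 - q) * t / (q * α * (1 - t))) *
        -((t ^ p - t ^ p * t) * (t - a * b * c * d * (t ^ p * t ^ p * t)) /
          (t ^ p * t * t ^ p * t)) := by
      rw [hA, bracket]
      generalize t ^ p = u at *
      have e3 : u - u * t = u * (1 - t) := by ring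
      rw [e3]
      field_simp
      ring
    rw [key2]
    linear_combination (-((1 - q) * t / (q * α * (1 - t)))) * key

variable {n : ℕ}

lemma op_columnVector (h : GenericParams a b c d t) {M : Matrix ℕ ℕ ℂ}
    (hM : IsTransitionMatrix a b c d t M) {q α : ℂ} (hq : q ≠ 0) (hα : α ≠ 0)
    (hαq : α ^ 2 = a * b * c * d / q) (r : ℕ) (hr : r ≤ n) :
    op a b c d q t α (columnVector M n (n - r)) =
      const n (eigenvalue q t α (column n r)) * toRat (columnVector M n (n - r)) := by
  set κ := -((1 - q) * t / (q * α * (1 - t))) with hκ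
  have key := eq_zero_of_forall_sum_eval_eq_zero (K := RatFun n) (recPoly a b c d t)
    (threeTerm_monic_natDegree _ _) (fun k => op a b c d q t α (columnVector M n k) -
      const n (κ * (awEigenvalue (a * b * c * d) t k - awEigenvalue (a * b * c * d) t n)) *
        toRat (columnVector M n k)) (n + 1) ?_ (n - r) (by omega)
  · rw [eigenvalue_column h hq hα hαq n r hr]
    exact sub_eq_zero.1 key
  · intro y
    have h1 := op_genFun (n := n) h hM hq hα y
    rw [← hκ, ← opLinear_apply a b c d q t α hq, genFun_eq_sum_columnVector hM, map_sum,
      interpolant, eval_finsetSum, toRat, map_sum, Finset.mul_sum, ← Finset.sum_sub_distrib,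
      Finset.mul_sum, ← sub_eq_zero, ← Finset.sum_sub_distrib] at h1
    rw [← h1]
    refine Finset.sum_congr rfl fun k _ => ?_
    have h2 : algebraMap (Laurent n) (RatFun n) (eval y (recPoly a b c d t k) • columnVector M n k) =
        const n (eval y (recPoly a b c d t k)) * toRat (columnVector M n k) :=
      (const_mul_toRat _ _).symm
    have h3 : eval (const n y) ((recPoly a b c d t k).map (algebraMap ℂ (RatFun n))) =
        const n (eval y (recPoly a b c d t k)) := by
      rw [const, eval_map_algebraMap, aeval_algebraMap_apply, coe_aeval_eq_eval]; rfl
    rw [h2, eval_mul, eval_C, h3, map_smul, Algebra.smul_def, opLinear_apply]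
    simp only [const, map_mul, map_sub]
    ring

lemma columnVector_eq_add {M : Matrix ℕ ℕ ℂ} (hM : IsTransitionMatrix a b c d t M) {r : ℕ}
    (hr : r ≤ n) : columnVector M n (n - r) =
      m (column n r) + ∑ s ∈ Finset.range r, M (n - r) (n - s) • m (column n s) := by
  have h1 : columnVector M n (n - r) =
      ∑ s ∈ Finset.range (n + 1), M (n - r) (n - s) • m (column n s) := by
    rw [columnVector, ← Finset.sum_range_reflect]
    refine Finset.sum_congr rfl fun s hs => ?_
    have hs := Finset.mem_range.1 hs
    rw [show n + 1 - 1 - s = n - s by omega, show n - (n - s) = s by omega]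
  have h2 : ∑ s ∈ Finset.range (r + 1), M (n - r) (n - s) • m (column n s) =
      ∑ s ∈ Finset.range (n + 1), M (n - r) (n - s) • m (column n s) := by
    refine Finset.sum_subset (Finset.range_mono (by omega)) fun s hs hs' => ?_
    simp only [Finset.mem_range] at hs hs'
    rw [hM.upper _ _ (by omega), zero_smul]
  rw [h1, ← h2, Finset.sum_range_succ, hM.diag, one_smul, add_comm]

/-! ### Existence and uniqueness -/

/-- The partitions below a column are the shorter columns. -/
lemma dominated_column_iff {r : ℕ} (hr : r ≤ n) (hn : 1 ≤ n) (μ : Fin n → ℕ) :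
    (Antitone μ ∧ Dominated μ (column n r) ∧ μ ≠ column n r) ↔ ∃ s < r, μ = column n s := by
  constructor
  · rintro ⟨hanti, hdom, hne⟩
    -- The first dominance inequality bounds the largest part by 1, so μ is a column; the last one
    -- bounds its length.
    have hle : ∀ i, μ i ≤ 1 := by
      intro i
      have h0 := hdom ⟨0, hn⟩
      have hI : Finset.Iic (⟨0, hn⟩ : Fin n) = {⟨0, hn⟩} := by
        ext j
        simp only [Finset.mem_Iic, Finset.mem_singleton, Fin.le_def, Fin.ext_iff]
        omega
      rw [hI, Finset.sum_singleton, Finset.sum_singleton] at h0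
      refine (hanti (show (⟨0, hn⟩ : Fin n) ≤ i from Nat.zero_le _)).trans (h0.trans ?_)
      rw [column]
      split_ifs <;> simp
    have hex : ∃ s : ℕ, ∀ i : Fin n, s ≤ i → μ i = 0 := ⟨n, fun i hi => by omega⟩
    classical
    have hspec := Nat.find_spec hex
    have hmin := fun k => Nat.find_min hex (m := k)
    have hfn : Nat.find hex ≤ n := Nat.find_min' hex fun i hi => by omega
    generalize Nat.find hex = s at hspec hmin hfn
    have hμ : μ = column n s := by
      ext i
      rw [column]
      split_ifs with h
      · have h1 : μ i ≠ 0 := fun h0 => hmin i h fun j hj =>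
          Nat.le_zero.1 ((hanti (show i ≤ j from hj)).trans h0.le)
        have := hle i
        omega
      · exact hspec i (by omega)
    have hsum := hdom ⟨n - 1, by omega⟩
    have hI : Finset.Iic (⟨n - 1, by omega⟩ : Fin n) = Finset.univ := by
      ext j
      simp only [Finset.mem_Iic, Finset.mem_univ, Fin.le_def, iff_true]
      omega
    rw [hI, hμ, sum_column hfn, sum_column hr] at hsum
    refine ⟨s, lt_of_le_of_ne hsum ?_, hμ⟩
    rintro rfl
    exact hne hμ
  · rintro ⟨s, hs, rfl⟩
    refine ⟨fun i j hij => ?_, fun k => Finset.sum_le_sum fun i _ => ?_, fun h => ?_⟩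
    · have : (i : ℕ) ≤ j := hij
      simp only [column]
      split_ifs <;> omega
    · simp only [column]
      split_ifs <;> omega
    · have := congrArg (fun μ : Fin n → ℕ => ∑ i, μ i) h
      simp only [sum_column hr, sum_column (hs.le.trans hr)] at this
      omega

lemma span_below_column {r : ℕ} (hr : r ≤ n) (hn : 1 ≤ n) :
    {Q : Laurent n | ∃ μ : Fin n → ℕ, Antitone μ ∧ Dominated μ (column n r) ∧
      μ ≠ column n r ∧ Q = m μ} = (fun s => m (column n s)) '' (Finset.range r : Set ℕ) := by
  ext Q
  simp only [Set.mem_ofPred_eq, Set.mem_image, Finset.coe_range, Set.mem_Iio]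
  constructor
  · rintro ⟨μ, h1, h2, h3, rfl⟩
    obtain ⟨s, hs, rfl⟩ := (dominated_column_iff hr hn μ).1 ⟨h1, h2, h3⟩
    exact ⟨s, hs, rfl⟩
  · rintro ⟨s, hs, rfl⟩
    obtain ⟨h1, h2, h3⟩ := (dominated_column_iff hr hn _).2 ⟨s, hs, rfl⟩
    exact ⟨_, h1, h2, h3, rfl⟩

lemma m_column_mem_span {M : Matrix ℕ ℕ ℂ} (hM : IsTransitionMatrix a b c d t M) {r s : ℕ}
    (hr : r ≤ n) (hs : s < r) : m (column n s) ∈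
      Submodule.span ℂ ((fun s => columnVector M n (n - s)) '' (Finset.range r : Set ℕ)) := by
  induction s using Nat.strong_induction_on with
  | _ s ih =>
    have h1 := columnVector_eq_add hM (show s ≤ n by omega)
    replace h1 := eq_sub_of_add_eq h1.symm
    rw [h1]
    refine Submodule.sub_mem _ (Submodule.subset_span ⟨s, by simpa using hs, rfl⟩)
      (Submodule.sum_mem _ fun k hk => Submodule.smul_mem _ _ (ih k ?_ ?_))
    · exact Finset.mem_range.1 hk
    · exact (Finset.mem_range.1 hk).trans hs

/-- The monomial x^{(1^r)} occurs in the vector for the column r but not in those of shorter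
columns, so the coefficients vanish from the top down. -/
lemma coeff_eq_zero_of_sum_columnVector_eq_zero {M : Matrix ℕ ℕ ℂ}
    (hM : IsTransitionMatrix a b c d t M) {r : ℕ} (hr : r ≤ n + 1) (β : ℕ → ℂ)
    (h : ∑ s ∈ Finset.range r, β s • columnVector M n (n - s) = 0) : ∀ s < r, β s = 0 := by
  induction r with
  | zero => intro s hs; omega
  | succ r ih =>
    have hcoef : ∀ s ≤ r, (columnVector M n (n - s)).coeff (fun i => ((column n r i : ℕ) : ℤ)) =
        if s = r then 1 else 0 := by
      intro s hs
      rw [columnVector_eq_add hM (by omega), AddMonoidAlgebra.coeff_add, Finsupp.add_apply,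
        coeff_m_column (by omega) (by omega), AddMonoidAlgebra.coeff_sum, Finsupp.finsetSum_apply,
        Finset.sum_eq_zero, add_zero]
      intro k hk
      have hk := Finset.mem_range.1 hk
      rw [AddMonoidAlgebra.coeff_smul, Finsupp.smul_apply, coeff_m_column (by omega) (by omega),
        if_neg (by omega), smul_zero]
    have h0 : β r = 0 := by
      have := congrArg (fun P : Laurent n => P.coeff (fun i => ((column n r i : ℕ) : ℤ))) h
      simp only [Finset.sum_range_succ, AddMonoidAlgebra.coeff_add, Finsupp.add_apply,
        AddMonoidAlgebra.coeff_smul, Finsupp.smul_apply, AddMonoidAlgebra.coeff_zero,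
        Finsupp.zero_apply] at this
      rw [AddMonoidAlgebra.coeff_sum, Finsupp.finsetSum_apply, Finset.sum_eq_zero,
        hcoef r le_rfl] at this
      · simpa using this
      · intro s hs
        have hs := Finset.mem_range.1 hs
        rw [AddMonoidAlgebra.coeff_smul, Finsupp.smul_apply, hcoef s hs.le, if_neg hs.ne, smul_zero]
    rw [Finset.sum_range_succ, h0, zero_smul, add_zero] at h
    intro s hs
    rcases (Nat.lt_succ_iff.1 hs).eq_or_lt with rfl | hs
    · exact h0
    · exact ih (by omega) h s hs

lemma eigenvalue_column_ne (h : GenericParams a b c d t) {q α : ℂ} (hq : q ≠ 0) (hq1 : q ≠ 1)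
    (hα : α ≠ 0) (hαq : α ^ 2 = a * b * c * d / q) {r s : ℕ} (hr : r ≤ n) (hs : s < r) :
    eigenvalue q t α (column n s) - eigenvalue q t α (column n r) ≠ 0 := by
  rw [eigenvalue_column h hq hα hαq n r hr, eigenvalue_column h hq hα hαq n s (by omega),
    ← mul_sub, sub_sub_sub_cancel_right]
  have ht1 : 1 - t ≠ 0 := by simpa using h.one_sub_pow_ne 0
  have hq' : 1 - q ≠ 0 := sub_ne_zero.2 hq1.symm
  refine mul_ne_zero (neg_ne_zero.2 (div_ne_zero (mul_ne_zero hq' h.t_ne)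
    (mul_ne_zero (mul_ne_zero hq hα) ht1))) ?_
  have := awEigenvalue_sub_ne_zero h (n - r) (r - s - 1)
  rwa [show n - r + (r - s - 1) + 1 = n - s by omega] at this

lemma isKoornwinder_columnVector (h : GenericParams a b c d t) {M : Matrix ℕ ℕ ℂ}
    (hM : IsTransitionMatrix a b c d t M) {q α : ℂ} (hq : q ≠ 0)
    (hα : α ≠ 0) (hαq : α ^ 2 = a * b * c * d / q) (hn : 1 ≤ n) {r : ℕ} (hr : r ≤ n) :
    IsKoornwinder a b c d q t α (column n r) (columnVector M n (n - r)) := by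
  refine ⟨?_, op_columnVector h hM hq hα hαq r hr⟩
  rw [span_below_column hr hn, columnVector_eq_add hM hr, add_sub_cancel_left]
  exact Submodule.sum_mem _ fun s hs => Submodule.smul_mem _ _
    (Submodule.subset_span ⟨s, by simpa using hs, rfl⟩)

lemma IsKoornwinder.eq_columnVector (h : GenericParams a b c d t) {M : Matrix ℕ ℕ ℂ}
    (hM : IsTransitionMatrix a b c d t M) {q α : ℂ} (hq : q ≠ 0) (hq1 : q ≠ 1)
    (hα : α ≠ 0) (hαq : α ^ 2 = a * b * c * d / q) (hn : 1 ≤ n) {r : ℕ} (hr : r ≤ n)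
    {P : Laurent n} (hP : IsKoornwinder a b c d q t α (column n r) P) :
    P = columnVector M n (n - r) := by
  have hV := isKoornwinder_columnVector h hM hq hα hαq hn hr
  have hspan := Submodule.sub_mem _ hP.triangular hV.triangular
  rw [sub_sub_sub_cancel_right, span_below_column hr hn] at hspan
  have hspan' : P - columnVector M n (n - r) ∈
      Submodule.span ℂ ((fun s => columnVector M n (n - s)) '' (Finset.range r : Set ℕ)) := by
    refine Submodule.span_le.2 ?_ hspan
    rintro _ ⟨s, hs, rfl⟩
    exact m_column_mem_span hM hr (by simpa using hs)
  obtain ⟨β, hβ⟩ := (Submodule.mem_span_image_finset_iff_exists_fun' ℂ).1 hspan'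
  have heig : opLinear a b c d q t α hq n (P - columnVector M n (n - r)) =
      const n (eigenvalue q t α (column n r)) * toRat (P - columnVector M n (n - r)) := by
    rw [map_sub, opLinear_apply, opLinear_apply, hP.eigen, hV.eigen, toRat, toRat, toRat, map_sub,
      mul_sub]
  -- The difference of the two solutions is a combination of shorter eigenvectors and has the
  -- eigenvalue of (1^r); independence and distinct eigenvalues kill every β.
  have hzero : ∑ s ∈ Finset.range r, (β s * (eigenvalue q t α (column n s) -
      eigenvalue q t α (column n r))) • columnVector M n (n - s) = 0 := by
    apply toRat_injective
    rw [← hβ, const_mul_toRat, map_sum, Finset.smul_sum, ← sub_eq_zero] at heig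
    rw [show toRat (0 : Laurent n) = 0 from map_zero _, ← heig, toRat, toRat, map_sum, map_sum,
      ← Finset.sum_sub_distrib]
    refine Finset.sum_congr rfl fun s hs => ?_
    have hs := Finset.mem_range.1 hs
    have h1 : ∀ (z : ℂ) (Q : Laurent n), algebraMap (Laurent n) (RatFun n) (z • Q) =
        const n z * toRat Q := fun z Q => (const_mul_toRat z Q).symm
    have h2 : opLinear a b c d q t α hq n (β s • columnVector M n (n - s)) = const n (β s) *
        (const n (eigenvalue q t α (column n s)) * toRat (columnVector M n (n - s))) := by
      rw [map_smul, opLinear_apply, op_columnVector h hM hq hα hαq s (by omega), Algebra.smul_def]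
      rfl
    rw [h2, smul_smul, h1, h1]
    simp only [const, map_mul, map_sub]
    ring
  have hβ0 : ∀ s < r, β s = 0 := fun s hs =>
    (mul_eq_zero.1 (coeff_eq_zero_of_sum_columnVector_eq_zero hM (by omega) _ hzero s hs)).resolve_right
      (eigenvalue_column_ne h hq hq1 hα hαq hr hs)
  rw [Finset.sum_eq_zero fun s hs => by rw [hβ0 s (Finset.mem_range.1 hs), zero_smul]] at hβ
  exact sub_eq_zero.1 hβ.symm

lemma finsum_smul_vecm {M : Matrix ℕ ℕ ℂ} (n i : ℕ) :
    ∑ᶠ j : ℕ, M i j • vecm n j = columnVector M n i := by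
  rw [finsum_eq_sum_of_support_subset (s := Finset.range (n + 1)), columnVector]
  · refine Finset.sum_congr rfl fun j hj => ?_
    rw [vecm, if_pos (Nat.lt_succ_iff.1 (Finset.mem_range.1 hj))]
  · intro j hj
    rw [Finset.coe_range, Set.mem_Iio]
    by_contra hlt
    exact hj (by simp only [vecm, if_neg (show ¬ j ≤ n by omega), smul_zero])

end Koornwinder
end

theorem theorem1p2 (a b c d t : ℂ)
    (ha : a ≠ 0) (hb : b ≠ 0) (hc : c ≠ 0) (hd : d ≠ 0) (ht : t ≠ 0)
    (ht_root : ∀ k : ℕ, 1 ≤ k → t ^ k ≠ 1)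
    (h_generic : ∀ k : ℤ, -1 ≤ k → a * b * c * d * t ^ k ≠ 1) :
    (∃! C : Matrix ℕ ℕ ℂ, Koornwinder.IsTransitionMatrix a b c d t C) ∧
      ∀ C : Matrix ℕ ℕ ℂ, Koornwinder.IsTransitionMatrix a b c d t C →
        ∀ q : ℂ, q ≠ 0 → ‖q‖ < 1 → ∀ α : ℂ, α ^ 2 = a * b * c * d / q → ∀ n : ℕ, 1 ≤ n →
          (∀ r : ℕ, r ≤ n → ∃! P : Koornwinder.Laurent n,
            Koornwinder.IsKoornwinder a b c d q t α (Koornwinder.column n r) P) ∧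
          ∀ i : ℕ, Koornwinder.vecP a b c d q t α n i =
            ∑ᶠ j : ℕ, C i j • Koornwinder.vecm n j := by
  have h : Koornwinder.GenericParams a b c d t := by
    -- Dividing by t shifts the exponent by one; k = 0 uses the assumption at exponent -1.
    refine ⟨ha, ht, ht_root, fun k h0 => h_generic ((k : ℤ) - 1) (by omega) ?_⟩
    rw [zpow_sub₀ ht, zpow_natCast, zpow_one, ← mul_div_assoc, ← sub_eq_zero.1 h0, div_self ht]
  refine ⟨Koornwinder.existsUnique_isTransitionMatrix a b c d t, ?_⟩
  intro C hC q hq hq1 α hαq n hn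
  have hq1' : q ≠ 1 := by
    rintro rfl
    simp at hq1
  have hα : α ≠ 0 := by
    rintro rfl
    have : a * b * c * d / q ≠ 0 :=
      div_ne_zero (mul_ne_zero (mul_ne_zero (mul_ne_zero ha hb) hc) hd) hq
    exact this (by rw [← hαq]; simp)
  have hunique : ∀ r : ℕ, r ≤ n → ∃! P : Koornwinder.Laurent n,
      Koornwinder.IsKoornwinder a b c d q t α (Koornwinder.column n r) P := fun r hr =>
    ⟨_, Koornwinder.isKoornwinder_columnVector h hC hq hα hαq hn hr, fun P hP =>
      hP.eq_columnVector h hC hq hq1' hα hαq hn hr⟩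
  refine ⟨hunique, fun i => ?_⟩
  rw [Koornwinder.finsum_smul_vecm, Koornwinder.vecP]
  split_ifs with hi
  · have hu := hunique (n - i) (Nat.sub_le n i)
    rw [Koornwinder.koornwinder, dif_pos hu]
    have := hu.choose_spec.1.eq_columnVector h hC hq hq1' hα hαq hn (Nat.sub_le n i)
    rw [this, show n - (n - i) = i by omega]
  -- For i > n only columns j ≤ n < i enter, where C is zero by triangularity.
  · rw [Koornwinder.columnVector, Finset.sum_eq_zero]
    intro j hj
    have hj := Finset.mem_range.1 hj
    rw [hC.upper i j (by omega), zero_smul]
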